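/- For $\alpha > 0$ let $X_\alpha$ be the symplectic manifold $S^2 \times S^2$ with the symplectic form $\omega_\alpha = 2(\alpha+1)\,\omega_{S^2} \oplus 2\alpha\,\omega_{S^2}$, where $\omega_{S^2}$ is the rotation-invariant area form on $S^2$ of total area $1$. For $a > 0$ and $|h| < a/2$ let $S^1_h \subset (S^2, a\,\omega_{S^2})$ be the circle of constant height such that the annulus between the equator and $S^1_h$ has signed area $h$. For $(x,y) \in (-1-\alpha, 1+\alpha) \times (-\alpha,\alpha)$ let $T(x,y) = S^1_x \times S^1_y \subset X_\alpha$ be the corresponding split torus, where $S^1_x$ lies in the first factor $(S^2, 2(\alpha+1)\,\omega_{S^2})$ and $S^1_y$ in the second factor $(S^2, 2\alpha\,\omega_{S^2})$. Put $r(x,y) = \max\{|x|-1, |y|\}$ and $\Sigma = \{(x,y) \in \mathbb{R}^2 : x = \pm(|y|+1)\} \cup [-1,1]\times\{0\}$. The packing number of a Lagrangian $L \subset X_\alpha$ is $$\#_P(L) = \sup\{N \in \mathbb{N} : \exists\, \phi_1,\dots,\phi_N \in \operatorname{Ham}(X_\alpha) \text{ with } \phi_i(L) \cap \phi_j(L)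 = \varnothing \text{ for all } i \ne j\} \in \mathbb{N} \cup \{\infty\},$$ where $\operatorname{Ham}(X_\alpha)$ is the set of time-one maps of flows of smooth time-dependent Hamiltonian functions on $X_\alpha$. **Corollary.** Let $\alpha > 0$ and let $T(x,y) \subset X_\alpha$ be a split torus with $(x,y) \notin \Sigma$ and $r(x,y)$ irrational. Then $\#_P(T(x,y)) = \infty$. (In particular $\#_P(T(x,0)) = \infty$ for every irrational $x$ with $1 < |x| < 1+\alpha$.) -/

import Mathlib

open scoped Manifold ContDiff Matrix

noncomputable section

namespace SplitPacking

section General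

variable {E H : Type*} [NormedAddCommGroup E] [NormedSpace ℝ E] [TopologicalSpace H]
  {E' H' : Type*} [NormedAddCommGroup E'] [NormedSpace ℝ E'] [TopologicalSpace H']

/-- A field of bilinear forms on the tangent spaces of a manifold `M`. -/
abbrev BilinField (I : ModelWithCorners ℝ E H) (M : Type*) [TopologicalSpace M]
    [ChartedSpace H M] : Type _ :=
  (p : M) → TangentSpace I p →ₗ[ℝ] TangentSpace I p →ₗ[ℝ] ℝ

/-- The pullback `f^* β`, i.e. `(f^* β)_p (u, v) = β_{f p} (df_p u, df_p v)`. -/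
def BilinField.pullback {I : ModelWithCorners ℝ E H} {I' : ModelWithCorners ℝ E' H'}
    {M : Type*} [TopologicalSpace M] [ChartedSpace H M]
    {N : Type*} [TopologicalSpace N] [ChartedSpace H' N]
    (β : BilinField I' N) (f : M → N) : BilinField I M :=
  fun p => (β (f p)).compl₁₂ (mfderiv I I' f p).toLinearMap (mfderiv I I' f p).toLinearMap

variable {I : ModelWithCorners ℝ E H} {M : Type*} [TopologicalSpace M] [ChartedSpace H M]

/-- `Φ` is the flow, started at the identity at time `0`, of the time-dependent Hamiltonian `F`
with respect to the two-form `Ω`: it is a smooth family of diffeomorphisms with `Φ_0 = id` and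
`Ω (d/dt Φ_t(p), v) = d(F_t)(v)` for all `t`, all `p` and all `v` tangent to `M` at `Φ_t(p)`. -/
structure IsHamiltonianFlow (Ω : BilinField I M) (F : ℝ → M → ℝ) (Φ : ℝ → M ≃ₘ⟮I, I⟯ M) :
    Prop where
  smooth_hamiltonian : ContMDiff (𝓘(ℝ, ℝ).prod I) 𝓘(ℝ, ℝ) ∞ (fun z : ℝ × M => F z.1 z.2)
  smooth_flow : ContMDiff (𝓘(ℝ, ℝ).prod I) I ∞ (fun z : ℝ × M => Φ z.1 z.2)
  flow_zero : ∀ p : M, Φ 0 p = p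
  hamilton_equation : ∀ (t : ℝ) (p : M) (v : TangentSpace I (Φ t p)),
    Ω (Φ t p) (mfderiv 𝓘(ℝ, ℝ) I (fun s : ℝ => Φ s p) t (1 : ℝ)) v =
      mvfderiv I (F t) (Φ t p) v

/-- The Hamiltonian diffeomorphisms `Ham(M, Ω)` of a closed symplectic manifold `(M, Ω)`: the
time-one maps of Hamiltonian flows. -/
def Ham (Ω : BilinField I M) : Set (M ≃ₘ⟮I, I⟯ M) :=
  {φ | ∃ (F : ℝ → M → ℝ) (Φ : ℝ → M ≃ₘ⟮I, I⟯ M), IsHamiltonianFlow Ω F Φ ∧ Φ 1 = φ}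

/-- The packing number of a subset `L` of a closed symplectic manifold `(M, Ω)`: the supremum in
`ℕ ∪ {∞}` of all `N` such that there are `φ_1, …, φ_N ∈ Ham(M, Ω)` for which the images
`φ_i(L)` are pairwise disjoint. -/
def packingNumber (Ω : BilinField I M) (L : Set M) : ℕ∞ :=
  sSup {N : ℕ∞ | ∃ n : ℕ, N = (n : ℕ∞) ∧ ∃ φ : Fin n → (M ≃ₘ⟮I, I⟯ M),
    (∀ i, φ i ∈ Ham Ω) ∧ ∀ i j, i ≠ j → Disjoint (φ i '' L) (φ j '' L)}

end General

/-- The two-sphere, as the unit sphere of Euclidean three-space. -/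
abbrev S2 : Type := Metric.sphere (0 : EuclideanSpace ℝ (Fin 3)) 1

/-- The bilinear form `(u, v) ↦ p · (u × v) = det (p, u, v)` on Euclidean three-space. -/
def tripleProduct (p : EuclideanSpace ℝ (Fin 3)) :
    EuclideanSpace ℝ (Fin 3) →ₗ[ℝ] EuclideanSpace ℝ (Fin 3) →ₗ[ℝ] ℝ :=
  LinearMap.mk₂ ℝ (fun u v => p.ofLp ⬝ᵥ (u.ofLp ⨯₃ v.ofLp))
    (by intros; simp) (by intros; simp) (by intros; simp) (by intros; simp)

/-- The two-form `p ↦ tripleProduct p` on Euclidean three-space. Its restriction to the unit sphere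
is the standard area form, for which the sphere has total area `4 π`. -/
def tripleForm : BilinField 𝓘(ℝ, EuclideanSpace ℝ (Fin 3)) (EuclideanSpace ℝ (Fin 3)) :=
  fun p => tripleProduct p

/-- The rotation-invariant area form `ω_{S²}` of total area `1`. -/
def sphereForm : BilinField (𝓡 2) S2 :=
  fun p => (1 / (4 * Real.pi)) • tripleForm.pullback (I := 𝓡 2) (Subtype.val : S2 → _) p

/-- The symplectic form `ω_α = 2 (α + 1) ω_{S²} ⊕ 2 α ω_{S²}` on `S² × S²`, where `⊕` is the sum
of the pullbacks under the two projections. -/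
def omega (α : ℝ) : BilinField ((𝓡 2).prod (𝓡 2)) (S2 × S2) :=
  fun p => (2 * (α + 1)) • sphereForm.pullback (I := (𝓡 2).prod (𝓡 2)) Prod.fst p
    + (2 * α) • sphereForm.pullback (I := (𝓡 2).prod (𝓡 2)) Prod.snd p

/-- The circle `S¹_h` of constant height in `S²(a) = (S², a ω_{S²})` such that the annulus between
it and the equator has signed area `h`, for `|h| < a / 2`. With respect to `a ω_{S²}` the annulus
between the equator and the circle at height `z` has signed area `a z / 2` (the area `2 π z` on the
unit sphere times `a / (4 π)`), so the circle `S¹_h` lies at height `2 h / a`. -/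
def heightCircle (a h : ℝ) : Set S2 :=
  {p | (p : EuclideanSpace ℝ (Fin 3)) 2 = 2 * h / a}

/-- The split torus `T(x, y) = S¹_x × S¹_y` in `S²(2 (α + 1)) × S²(2 α)`, for `|x| < 1 + α` and
`|y| < α`. -/
def splitTorus (α x y : ℝ) : Set (S2 × S2) :=
  heightCircle (2 * (α + 1)) x ×ˢ heightCircle (2 * α) y

/-- The number `r(x, y) = max {|x| - 1, |y|}`. -/
def tableSize (x y : ℝ) : ℝ := max (|x| - 1) |y|

/-- The set `Σ = {x = ± (|y| + 1)} ∪ [-1, 1] × {0}`. -/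
def SigmaSet : Set (ℝ × ℝ) :=
  {z | z.1 = |z.2| + 1 ∨ z.1 = -(|z.2| + 1)} ∪ Set.Icc (-1) 1 ×ˢ {0}

end SplitPacking

end

/-! The torus over `(x, y)` lies in the level `x + y` of the moment map `level` of the diagonal
circle action. A Hamiltonian invariant under this action preserves each level and acts on the
reduced sphere. Multiplied by a cutoff in the level, it stays smooth even if the original function
is smooth only near that level; the cutoff's derivative merely adds a drift along circle orbits,
which preserves every split torus.

For levels in `(-1, 1)` the first point is never a pole. Rotating the second point back by the phase
of the first identifies the reduced space with a round sphere, and a half turn of it reverses the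
second height: `(x, y)` goes to `(x + 2y, -y)`. For levels above `1` neither point is a south pole,
so area-preserving disc charts `W`, `V` exist, and a unitary quarter turn exchanges `|W|²` and
`|V|²`: `(x, y)` goes to `(1 + y, x - 1)`. Both moves send a boundary point of the rectangle `max
(|x| - 1, |y|) = r` to the other end of the chord of slope `-1` through it. With the reflections in
both coordinates, which come from rotations of the factors, they realise a billiard in this
rectangle (`reachable_annulus`, `reachable_corner`, `reachable_sub_two`).

On the upper side, the billiard modulo reflections sends `s` to `s + 2r` or `s - 2`: a rotation by
`2r` of a circle of length `2 + 2r`. For irrational `r` its orbits are infinite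
(`billiard_iterate_injective`). An orbit can be followed unless it meets `s = 1 - r`, on the
critical level `1`; of the orbits of `s` and `-s` at least one avoids it
(`billiard_iterate_ne_corner`). Thus one torus can be moved into infinitely many split tori with
distinct first heights, which are pairwise disjoint. -/

open scoped Manifold ContDiff Matrix Topology

noncomputable section

namespace SplitPacking

/-! ### Hamiltonian flows: autonomous flows from one-parameter groups, and composition. -/

section HamiltonianFlows

variable {E H : Type*} [NormedAddCommGroup E] [NormedSpace ℝ E] [TopologicalSpace H]
  {I : ModelWithCorners ℝ E H} {M : Type*} [TopologicalSpace M] [ChartedSpace H M]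

/-- The curve `c` satisfies Hamilton's equation for `k • F` at time `t`. -/
def SatisfiesHamilton (Ω : BilinField I M) (F : M → ℝ) (c : ℝ → M) (t k : ℝ) : Prop :=
  ∀ v : TangentSpace I (c t),
    Ω (c t) (mfderiv 𝓘(ℝ, ℝ) I c t (1 : ℝ)) v = k * mvfderiv I F (c t) v

theorem SatisfiesHamilton.comp {Ω : BilinField I M} {F : M → ℝ} {c : ℝ → M} {t k k' : ℝ}
    {τ : ℝ → ℝ} (h : SatisfiesHamilton Ω F c (τ t) k) (hτ : HasDerivAt τ k' t)
    (hc : MDifferentiableAt 𝓘(ℝ, ℝ) I c (τ t)) :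
    SatisfiesHamilton Ω F (c ∘ τ) t (k' * k) := by
  intro v
  have h1 : mfderiv 𝓘(ℝ, ℝ) I (c ∘ τ) t (1 : ℝ) =
      k' • (mfderiv 𝓘(ℝ, ℝ) I c (τ t) (1 : ℝ)) := by
    have h2 : mfderiv 𝓘(ℝ, ℝ) 𝓘(ℝ, ℝ) τ t (1 : ℝ) = k' • (1 : ℝ) := by
      rw [mfderiv_eq_fderiv]
      exact hτ.deriv.trans (mul_one k').symm
    exact (mfderiv_comp_apply t hc hτ.differentiableAt.mdifferentiableAt _).trans
      ((congrArg (mfderiv 𝓘(ℝ, ℝ) I c (τ t)) h2).trans (map_smul _ _ _))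
  have h3 := h v
  rw [h1]
  change Ω (c (τ t)) (k' • _) v = _
  rw [map_smul, LinearMap.smul_apply, h3, smul_eq_mul, mul_assoc]
  rfl

theorem SatisfiesHamilton.congr {Ω : BilinField I M} {F : M → ℝ} {c c' : ℝ → M} {t k : ℝ}
    (h : SatisfiesHamilton Ω F c' t k) (hc : c =ᶠ[𝓝 t] c') :
    SatisfiesHamilton Ω F c t k := by
  intro v
  -- The tangent spaces at `c t` and `c' t` are different types, so the comparison is made in the
  -- model space `E`.
  have key : ∀ (x y : M), x = y → ∀ a b : E,
      (Ω y : E →ₗ[ℝ] E →ₗ[ℝ] ℝ) a b = k * (mvfderiv I F y : E →L[ℝ] ℝ) b →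
      (Ω x : E →ₗ[ℝ] E →ₗ[ℝ] ℝ) a b = k * (mvfderiv I F x : E →L[ℝ] ℝ) b := by
    rintro x y rfl a b hab
    exact hab
  have h1 : (mfderiv 𝓘(ℝ, ℝ) I c t : ℝ →L[ℝ] E) = mfderiv 𝓘(ℝ, ℝ) I c' t := hc.mfderiv_eq
  have h2 := key (c t) (c' t) hc.eq_of_nhds ((mfderiv 𝓘(ℝ, ℝ) I c' t : ℝ →L[ℝ] E) (1 : ℝ)) v (h v)
  rw [← h1] at h2
  exact h2

/-- A smooth one-parameter group satisfying Hamilton's equation at time `0` is the flow of an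
autonomous Hamiltonian. -/
theorem exists_isHamiltonianFlow_of_group {Ω : BilinField I M} {F : M → ℝ} {φ : ℝ → M → M}
    (hF : ContMDiff I 𝓘(ℝ, ℝ) ∞ F)
    (hφ : ContMDiff (𝓘(ℝ, ℝ).prod I) I ∞ (fun z : ℝ × M => φ z.1 z.2))
    (h0 : ∀ p, φ 0 p = p) (hadd : ∀ s t p, φ (s + t) p = φ s (φ t p))
    (hham : ∀ p, SatisfiesHamilton Ω F (fun s => φ s p) 0 1) :
    ∃ Φ : ℝ → M ≃ₘ⟮I, I⟯ M, IsHamiltonianFlow Ω (fun _ => F) Φ ∧ ∀ t p, Φ t p = φ t p := by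
  have hsm : ∀ t, ContMDiff I I ∞ (φ t) := fun t =>
    hφ.comp (contMDiff_const.prodMk contMDiff_id)
  have hcurve : ∀ p, ContMDiff 𝓘(ℝ, ℝ) I ∞ (fun s => φ s p) := fun p =>
    hφ.comp (contMDiff_id.prodMk contMDiff_const)
  refine ⟨fun t => ⟨⟨φ t, φ (-t), fun p => ?_, fun p => ?_⟩, hsm t, hsm (-t)⟩, ?_, fun _ _ => rfl⟩
  · rw [← hadd, neg_add_cancel, h0]
  · rw [← hadd, add_neg_cancel, h0]
  refine ⟨hF.comp contMDiff_snd, hφ, h0, fun t p v => ?_⟩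
  have h1 : SatisfiesHamilton Ω F (fun s => φ s p) t 1 := by
    -- By the group law the orbit near time `t` is the orbit of `φ t p` near time `0`, shifted in
    -- time.
    have h2 : (fun s => φ s p) = (fun s => φ s (φ t p)) ∘ (fun s => s - t) := by
      funext s
      simp [← hadd]
    rw [h2]
    have h3 := SatisfiesHamilton.comp (Ω := Ω) (F := F) (c := fun s => φ s (φ t p)) (t := t)
      (τ := fun s => s - t) (k := 1) (k' := 1) ?_ ((hasDerivAt_id t).sub_const t)
      (((hcurve (φ t p)).mdifferentiable (by simp)) _)
    · simpa using h3
    · rw [sub_self]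
      exact hham (φ t p)
  exact (h1 v).trans (one_mul _)

theorem refl_mem_Ham (Ω : BilinField I M) : Diffeomorph.refl I M ∞ ∈ Ham Ω := by
  refine ⟨fun _ _ => 0, fun _ => Diffeomorph.refl I M ∞,
    ⟨contMDiff_const, contMDiff_snd, fun _ => rfl, fun t p v => ?_⟩, rfl⟩
  have h1 : mfderiv 𝓘(ℝ, ℝ) I (fun _ : ℝ => Diffeomorph.refl I M ∞ p) t = 0 := mfderiv_const
  have h2 : mvfderiv I (fun _ : M => (0 : ℝ)) (Diffeomorph.refl I M ∞ p) = 0 := by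
    rw [mvfderiv, mfderiv_const]
    rfl
  rw [h1, h2]
  exact LinearMap.map_zero₂ (Ω _) v

theorem smoothTransition_eventuallyEq_zero {a b t : ℝ} (h : a * t + b < 0) :
    (fun s : ℝ => Real.smoothTransition (a * s + b)) =ᶠ[𝓝 t] fun _ => 0 := by
  have hc : Continuous fun s : ℝ => a * s + b := by fun_prop
  filter_upwards [hc.continuousAt.eventually (gt_mem_nhds h)] with s hs
  exact Real.smoothTransition.zero_of_nonpos hs.le

theorem smoothTransition_eventuallyEq_one {a b t : ℝ} (h : 1 < a * t + b) :
    (fun s : ℝ => Real.smoothTransition (a * s + b)) =ᶠ[𝓝 t] fun _ => 1 := by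
  have hc : Continuous fun s : ℝ => a * s + b := by fun_prop
  filter_upwards [hc.continuousAt.eventually (lt_mem_nhds h)] with s hs
  exact Real.smoothTransition.one_of_one_le hs.le

/-- Hamiltonian diffeomorphisms are closed under composition: run one flow after the other. -/
theorem trans_mem_Ham {Ω : BilinField I M} {φ ψ : M ≃ₘ⟮I, I⟯ M} (hφ : φ ∈ Ham Ω)
    (hψ : ψ ∈ Ham Ω) : φ.trans ψ ∈ Ham Ω := by
  obtain ⟨F, Φ, hΦ, rfl⟩ := hφ
  obtain ⟨G, Ψ, hΨ, rfl⟩ := hψ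
  -- `σ` rises from `0` to `1` on `[0, 1/3]` and `τ` on `[2/3, 1]`. Hence one of the two
  -- reparametrised flows is at rest near every time, and the Hamiltonians, scaled by the speeds,
  -- can simply be added.
  set σ : ℝ → ℝ := fun s => Real.smoothTransition (3 * s + 0) with hσ
  set τ : ℝ → ℝ := fun s => Real.smoothTransition (3 * s + -2) with hτ
  have hσs : ContDiff ℝ ∞ σ := Real.smoothTransition.contDiff.comp (by fun_prop)
  have hτs : ContDiff ℝ ∞ τ := Real.smoothTransition.contDiff.comp (by fun_prop)
  have hσ' : ContDiff ℝ ∞ (deriv σ) := (contDiff_infty_iff_deriv.1 hσs).2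
  have hτ' : ContDiff ℝ ∞ (deriv τ) := (contDiff_infty_iff_deriv.1 hτs).2
  have h1 : ∀ {f : ℝ → ℝ}, ContDiff ℝ ∞ f →
      ContMDiff (𝓘(ℝ, ℝ).prod I) 𝓘(ℝ, ℝ) ∞ (fun z : ℝ × M => f z.1) := fun hf =>
    hf.contMDiff.comp contMDiff_fst
  refine ⟨fun t p => deriv σ t * F (σ t) p + deriv τ t * G (τ t) p,
    fun t => (Φ (σ t)).trans (Ψ (τ t)), ⟨?_, ?_, ?_, ?_⟩, ?_⟩
  · exact ((h1 hσ').mul (hΦ.smooth_hamiltonian.comp ((h1 hσs).prodMk contMDiff_snd))).add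
      ((h1 hτ').mul (hΨ.smooth_hamiltonian.comp ((h1 hτs).prodMk contMDiff_snd)))
  · exact hΨ.smooth_flow.comp ((h1 hτs).prodMk
      (hΦ.smooth_flow.comp ((h1 hσs).prodMk contMDiff_snd)))
  · intro p
    have e1 : σ 0 = 0 := by simp [hσ, Real.smoothTransition.zero_of_nonpos]
    have e2 : τ 0 = 0 := Real.smoothTransition.zero_of_nonpos (by norm_num)
    simp [e1, e2, hΦ.flow_zero, hΨ.flow_zero]
  · intro t p v
    have hdiff : ∀ {Θ : ℝ → M ≃ₘ⟮I, I⟯ M} {K : ℝ → M → ℝ}, IsHamiltonianFlow Ω K Θ → ∀ q s,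
        MDifferentiableAt 𝓘(ℝ, ℝ) I (fun s => Θ s q) s := fun hΘ q s =>
      ((hΘ.smooth_flow.comp (contMDiff_id.prodMk contMDiff_const)).mdifferentiable (by simp)) s
    have hFd : ∀ {K : ℝ → M → ℝ} {Θ : ℝ → M ≃ₘ⟮I, I⟯ M}, IsHamiltonianFlow Ω K Θ → ∀ s q,
        MDifferentiableAt I 𝓘(ℝ, ℝ) (K s) q := fun hΘ s q =>
      ((hΘ.smooth_hamiltonian.comp (contMDiff_const.prodMk contMDiff_id)).mdifferentiable
        (by simp)) q
    have hmul : ∀ (K : M → ℝ) (k : ℝ) (q : M), MDifferentiableAt I 𝓘(ℝ, ℝ) K q →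
        ∀ w, mvfderiv I (fun p => k * K p) q w = k * mvfderiv I K q w := by
      intro K k q hK w
      have h := (hK.hasMFDerivAt.const_smul k).mfderiv
      have h' : mvfderiv I (fun p => k * K p) q = k • mvfderiv I K q := by
        unfold mvfderiv
        change _ ∘L mfderiv I 𝓘(ℝ, ℝ) (k • K) q = _
        rw [h]
        rfl
      rw [h']
      rfl
    rcases lt_or_ge t (1 / 2) with ht | ht
    · have hz : τ =ᶠ[𝓝 t] fun _ => 0 := smoothTransition_eventuallyEq_zero (by linarith)
      have hd : deriv τ t = 0 := by rw [hz.deriv_eq]; simp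
      have hs : SatisfiesHamilton Ω (F (σ t)) (fun s => Ψ (τ s) (Φ (σ s) p)) t (deriv σ t * 1) := by
        refine SatisfiesHamilton.congr (c' := (fun s => Φ s p) ∘ σ) ?_ ?_
        · refine SatisfiesHamilton.comp (c := fun s => Φ s p) (fun v => ?_)
            (hσs.differentiable (by simp) t).hasDerivAt (hdiff hΦ p _)
          rw [one_mul]
          exact hΦ.hamilton_equation _ _ _
        · filter_upwards [hz] with s hs
          simp [hs, hΨ.flow_zero]
      have e : (fun q => deriv σ t * F (σ t) q + deriv τ t * G (τ t) q) =
          fun q => deriv σ t * F (σ t) q := by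
        funext q
        simp [hd]
      rw [e, hmul _ _ _ (hFd hΦ _ _)]
      rw [← mul_one (deriv σ t)]
      exact hs v
    · have hz : σ =ᶠ[𝓝 t] fun _ => 1 := smoothTransition_eventuallyEq_one (by linarith)
      have hd : deriv σ t = 0 := by rw [hz.deriv_eq]; simp
      have hs : SatisfiesHamilton Ω (G (τ t)) (fun s => Ψ (τ s) (Φ (σ s) p)) t (deriv τ t * 1) := by
        refine SatisfiesHamilton.congr (c' := (fun s => Ψ s (Φ 1 p)) ∘ τ) ?_ ?_
        · refine SatisfiesHamilton.comp (c := fun s => Ψ s (Φ 1 p)) (fun v => ?_)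
            (hτs.differentiable (by simp) t).hasDerivAt (hdiff hΨ _ _)
          rw [one_mul]
          exact hΨ.hamilton_equation _ _ _
        · filter_upwards [hz] with s hs
          simp [hs]
      have e : (fun q => deriv σ t * F (σ t) q + deriv τ t * G (τ t) q) =
          fun q => deriv τ t * G (τ t) q := by
        funext q
        simp [hd]
      rw [e, hmul _ _ _ (hFd hΨ _ _)]
      rw [← mul_one (deriv τ t)]
      exact hs v
  · have e1 : σ 1 = 1 := Real.smoothTransition.one_of_one_le (by norm_num)
    have e2 : τ 1 = 1 := Real.smoothTransition.one_of_one_le (by norm_num)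
    simp [e1, e2]

end HamiltonianFlows

/-! ### The symplectic form and Hamilton's equation in ambient coordinates. -/

section SphereProduct

/-- Euclidean three-space. -/
abbrev E3 : Type := EuclideanSpace ℝ (Fin 3)

instance fact_finrank_E3 : Fact (Module.finrank ℝ E3 = 2 + 1) := ⟨by simp⟩

/-- The model with corners of `S² × S²`. -/
abbrev I22 := (𝓡 2).prod (𝓡 2)

theorem contMDiff_val : ContMDiff (𝓡 2) 𝓘(ℝ, E3) ∞ (Subtype.val : S2 → E3) :=
  contMDiff_coe_sphere

theorem contMDiff_val_fst :
    ContMDiff I22 𝓘(ℝ, E3) ∞ (fun q : S2 × S2 => (q.1 : E3)) :=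
  contMDiff_val.comp contMDiff_fst

theorem contMDiff_val_snd :
    ContMDiff I22 𝓘(ℝ, E3) ∞ (fun q : S2 × S2 => (q.2 : E3)) :=
  contMDiff_val.comp contMDiff_snd

/-- The differential of the first component, as a map into Euclidean three-space. -/
def dfst (q : S2 × S2) : TangentSpace I22 q →L[ℝ] E3 :=
  mfderiv I22 𝓘(ℝ, E3) (fun q : S2 × S2 => (q.1 : E3)) q

/-- The differential of the second component, as a map into Euclidean three-space. -/
def dsnd (q : S2 × S2) : TangentSpace I22 q →L[ℝ] E3 :=
  mfderiv I22 𝓘(ℝ, E3) (fun q : S2 × S2 => (q.2 : E3)) q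

theorem omega_apply (α : ℝ) (q : S2 × S2) (X Y : TangentSpace I22 q) :
    omega α q X Y = (α + 1) / (2 * Real.pi) * tripleProduct q.1 (dfst q X) (dfst q Y) +
      α / (2 * Real.pi) * tripleProduct q.2 (dsnd q X) (dsnd q Y) := by
  have hv : ∀ p : S2, MDifferentiableAt (𝓡 2) 𝓘(ℝ, E3) (Subtype.val : S2 → E3) p :=
    fun p => contMDiff_val.mdifferentiable (by simp) p
  have h1 : ∀ Z : TangentSpace I22 q, dfst q Z = mfderiv (𝓡 2) 𝓘(ℝ, E3) (Subtype.val : S2 → E3) q.1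
      (mfderiv I22 (𝓡 2) Prod.fst q Z) := fun Z =>
    mfderiv_comp_apply q (hv _) mdifferentiableAt_fst Z
  have h2 : ∀ Z : TangentSpace I22 q, dsnd q Z = mfderiv (𝓡 2) 𝓘(ℝ, E3) (Subtype.val : S2 → E3) q.2
      (mfderiv I22 (𝓡 2) Prod.snd q Z) := fun Z =>
    mfderiv_comp_apply q (hv _) mdifferentiableAt_snd Z
  rw [h1, h1, h2, h2]
  change (2 * (α + 1)) * (1 / (4 * Real.pi) * _) + (2 * α) * (1 / (4 * Real.pi) * _) = _
  have hpi := Real.pi_ne_zero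
  rw [← mul_assoc, ← mul_assoc]
  congr 1
  · congr 1
    field_simp
    ring
  · congr 1
    field_simp
    ring

theorem S2.sum_sq (p : S2) : (p : E3) 0 ^ 2 + (p : E3) 1 ^ 2 + (p : E3) 2 ^ 2 = 1 := by
  have h : ‖(p : E3)‖ = 1 := by simp
  have h2 := EuclideanSpace.norm_sq_eq (p : E3)
  rw [h, Fin.sum_univ_three] at h2
  simpa using h2.symm

/-- Differentiate `‖f‖² = 1`. -/
theorem orthogonal_of_constant_norm {q : S2 × S2} {f : S2 × S2 → S2}
    (hf : MDifferentiableAt I22 𝓘(ℝ, E3) (fun q => (f q : E3)) q) (X : TangentSpace I22 q) :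
    inner ℝ (f q : E3) (mfderiv I22 𝓘(ℝ, E3) (fun q => (f q : E3)) q X : E3) = 0 := by
  have hN : HasFDerivAt (fun u : E3 => ‖u‖ ^ 2) (2 • (innerSL ℝ (f q : E3))) (f q : E3) :=
    (hasStrictFDerivAt_norm_sq _).hasFDerivAt
  have h1 := hN.hasMFDerivAt.comp q hf.hasMFDerivAt
  have h2 : ((fun u : E3 => ‖u‖ ^ 2) ∘ fun q => (f q : E3)) = fun _ => (1 : ℝ) := by
    funext q
    simp
  rw [h2] at h1
  have h3 := hasMFDerivAt_unique h1 (hasMFDerivAt_const (1 : ℝ) q)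
  have h4 := congrArg (fun L => L X) h3
  change 2 • inner ℝ (f q : E3) (mfderiv I22 𝓘(ℝ, E3) (fun q => (f q : E3)) q X : E3) = (0 : ℝ) at h4
  simpa using h4

theorem inner_E3 (u v : E3) : inner ℝ u v = u 0 * v 0 + u 1 * v 1 + u 2 * v 2 := by
  rw [PiLp.inner_apply, Fin.sum_univ_three]
  simp [mul_comm]

theorem dfst_orthogonal (q : S2 × S2) (X : TangentSpace I22 q) :
    inner ℝ (q.1 : E3) (dfst q X) = 0 :=
  orthogonal_of_constant_norm (f := Prod.fst) (contMDiff_val_fst.mdifferentiable (by simp) q) X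

theorem dsnd_orthogonal (q : S2 × S2) (X : TangentSpace I22 q) :
    inner ℝ (q.2 : E3) (dsnd q X) = 0 :=
  orthogonal_of_constant_norm (f := Prod.snd) (contMDiff_val_snd.mdifferentiable (by simp) q) X

theorem mfderiv_curve_of_hasDerivAt {c : ℝ → S2 × S2} {t : ℝ} {f : S2 × S2 → E3} {a : E3}
    (hf : MDifferentiableAt I22 𝓘(ℝ, E3) f (c t)) (hc : MDifferentiableAt 𝓘(ℝ, ℝ) I22 c t)
    (ha : HasDerivAt (fun s => f (c s)) a t) :
    (mfderiv I22 𝓘(ℝ, E3) f (c t) (mfderiv 𝓘(ℝ, ℝ) I22 c t (1 : ℝ)) : E3) = a := by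
  have h1 := mfderiv_comp_apply t hf hc (1 : ℝ)
  have h2 : (mfderiv 𝓘(ℝ, ℝ) 𝓘(ℝ, E3) (f ∘ c) t (1 : ℝ) : E3) = a := by
    rw [mfderiv_eq_fderiv]
    exact ha.deriv
  exact h1.symm.trans h2

theorem mvfderiv_of_hasFDerivAt {F : S2 × S2 → ℝ} {Ft : E3 × E3 → ℝ} {L : E3 × E3 →L[ℝ] ℝ}
    {q : S2 × S2} (hF : F =ᶠ[𝓝 q] fun q => Ft (q.1, q.2))
    (hL : HasFDerivAt Ft L ((q.1 : E3), (q.2 : E3))) (X : TangentSpace I22 q) :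
    mvfderiv I22 F q X = L (dfst q X, dsnd q X) := by
  have h1 := (contMDiff_val_fst.mdifferentiable (by simp) q).hasMFDerivAt
  have h2 := (contMDiff_val_snd.mdifferentiable (by simp) q).hasMFDerivAt
  have h3 : HasMFDerivAt I22 𝓘(ℝ, E3 × E3) (fun q : S2 × S2 => ((q.1 : E3), (q.2 : E3))) q
    ((dfst q).prod (dsnd q)) := ⟨h1.1.prodMk h2.1, h1.2.prodMk h2.2⟩
  have h4 := (hL.hasMFDerivAt.comp q h3).congr_of_eventuallyEq hF
  unfold mvfderiv
  rw [h4.mfderiv]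
  rfl

/-- Hamilton's equation on `S² × S²`, checked in the ambient coordinates. -/
theorem satisfiesHamilton_of_hasDerivAt {α : ℝ} {F : S2 × S2 → ℝ} {Ft : E3 × E3 → ℝ}
    {c : ℝ → S2 × S2} {t : ℝ} {a b : E3}
    (hc : MDifferentiableAt 𝓘(ℝ, ℝ) I22 c t)
    (ha : HasDerivAt (fun s => ((c s).1 : E3)) a t) (hb : HasDerivAt (fun s => ((c s).2 : E3)) b t)
    (hF : F =ᶠ[𝓝 (c t)] fun q => Ft (q.1, q.2))
    (hFt : DifferentiableAt ℝ Ft (((c t).1 : E3), ((c t).2 : E3)))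
    (h : ∀ v w : E3, inner ℝ ((c t).1 : E3) v = 0 → inner ℝ ((c t).2 : E3) w = 0 →
      HasDerivAt (fun s : ℝ => Ft (((c t).1 : E3) + s • v, ((c t).2 : E3) + s • w))
        ((α + 1) / (2 * Real.pi) * tripleProduct (c t).1 a v +
          α / (2 * Real.pi) * tripleProduct (c t).2 b w) 0) :
    SatisfiesHamilton (omega α) F c t 1 := by
  intro X
  rw [omega_apply, one_mul, mvfderiv_of_hasFDerivAt hF hFt.hasFDerivAt]
  have h1 : dfst (c t) (mfderiv 𝓘(ℝ, ℝ) I22 c t (1 : ℝ)) = a :=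
    mfderiv_curve_of_hasDerivAt (contMDiff_val_fst.mdifferentiable (by simp) _) hc ha
  have h2 : dsnd (c t) (mfderiv 𝓘(ℝ, ℝ) I22 c t (1 : ℝ)) = b :=
    mfderiv_curve_of_hasDerivAt (contMDiff_val_snd.mdifferentiable (by simp) _) hc hb
  rw [h1, h2]
  have h3 := h _ _ (dfst_orthogonal (c t) X) (dsnd_orthogonal (c t) X)
  -- Both values are derivatives at `0` of `Ft` along the same straight line. The line leaves the
  -- spheres, but only its velocity matters, and that is the tangent vector `X` seen in the ambient
  -- space.
  refine h3.unique ?_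
  set v := dfst (c t) X
  set w := dsnd (c t) X
  have h4 : HasDerivAt (fun s : ℝ => (((c t).1 : E3) + s • v, ((c t).2 : E3) + s • w)) (v, w) 0 := by
    have e : ∀ x y : E3, HasDerivAt (fun s : ℝ => x + s • y) y 0 := fun x y => by
      simpa using ((hasDerivAt_id (0 : ℝ)).smul_const y).const_add x
    exact (e _ _).prodMk (e _ _)
  have h5 : HasFDerivAt Ft (fderiv ℝ Ft (((c t).1 : E3), ((c t).2 : E3)))
      (((c t).1 : E3) + (0 : ℝ) • v, ((c t).2 : E3) + (0 : ℝ) • w) := by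
    simpa using hFt.hasFDerivAt
  exact h5.comp_hasDerivAt (0 : ℝ) h4

theorem tripleProduct_apply (p u v : E3) : tripleProduct p u v =
    p 0 * (u 1 * v 2 - u 2 * v 1) + p 1 * (u 2 * v 0 - u 0 * v 2) +
      p 2 * (u 0 * v 1 - u 1 * v 0) := by
  simp [tripleProduct, crossProduct, Matrix.vecHead, Matrix.vecTail]
  ring

end SphereProduct

/-! ### Complex-plus-height coordinates, and flows defined on a range of levels. -/

section Coordinates

/-- The point of Euclidean three-space with horizontal part `c.1` and height `c.2`. -/
def toE3 (c : ℂ × ℝ) : E3 := !₂[c.1.re, c.1.im, c.2]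

@[simp] theorem toE3_zero (c : ℂ × ℝ) : toE3 c 0 = c.1.re := rfl
@[simp] theorem toE3_one (c : ℂ × ℝ) : toE3 c 1 = c.1.im := rfl
@[simp] theorem toE3_two (c : ℂ × ℝ) : toE3 c 2 = c.2 := rfl

theorem contDiff_toE3 : ContDiff ℝ ∞ toE3 := by
  rw [contDiff_euclidean]
  intro i
  fin_cases i
  · exact Complex.reCLM.contDiff.comp contDiff_fst
  · exact Complex.imCLM.contDiff.comp contDiff_fst
  · exact contDiff_snd

theorem hasDerivAt_toE3 {f : ℝ → ℂ} {g : ℝ → ℝ} {f' : ℂ} {g' t : ℝ} (hf : HasDerivAt f f' t)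
    (hg : HasDerivAt g g' t) : HasDerivAt (fun s => toE3 (f s, g s)) (toE3 (f', g')) t := by
  let L : ℂ × ℝ →ₗ[ℝ] E3 :=
    { toFun := toE3
      map_add' := fun x y => by ext i; fin_cases i <;> simp [toE3]
      map_smul' := fun r x => by ext i; fin_cases i <;> simp [toE3] }
  exact L.toContinuousLinearMap.hasFDerivAt.comp_hasDerivAt t (hf.prodMk hg)

/-- The coordinates satisfy the equation of the unit sphere. -/
def OnSphere (c : ℂ × ℝ) : Prop := Complex.normSq c.1 + c.2 ^ 2 = 1

theorem OnSphere.mem_sphere {c : ℂ × ℝ} (h : OnSphere c) :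
    toE3 c ∈ Metric.sphere (0 : E3) 1 := by
  have h2 := EuclideanSpace.norm_sq_eq (toE3 c)
  rw [Fin.sum_univ_three] at h2
  simp only [toE3_zero, toE3_one, toE3_two, Real.norm_eq_abs, sq_abs] at h2
  have h3 : ‖toE3 c‖ ^ 2 = 1 := by
    rw [h2, ← h, Complex.normSq_apply]
    ring
  rw [mem_sphere_zero_iff_norm]
  nlinarith [norm_nonneg (toE3 c)]

open Classical in
/-- The point of the sphere with given coordinates, with an arbitrary value if there is none. -/
def ofCoord (c : ℂ × ℝ) : S2 :=
  if h : OnSphere c then ⟨toE3 c, h.mem_sphere⟩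
  else ⟨toE3 (0, 1), OnSphere.mem_sphere (by simp [OnSphere])⟩

/-- The horizontal part and the height of a point of the sphere. -/
def coord (p : S2) : ℂ × ℝ := (⟨(p : E3) 0, (p : E3) 1⟩, (p : E3) 2)

theorem onSphere_coord (p : S2) : OnSphere (coord p) := by
  have := S2.sum_sq p
  simp only [OnSphere, coord, Complex.normSq_apply]
  linarith

theorem toE3_coord (p : S2) : toE3 (coord p) = p := by
  ext i
  fin_cases i <;> rfl

theorem ofCoord_val {c : ℂ × ℝ} (h : OnSphere c) : (ofCoord c : E3) = toE3 c := by
  simp [ofCoord, h]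

theorem coord_toE3 {p : S2} {c : ℂ × ℝ} (h : (p : E3) = toE3 c) : coord p = c := by
  simp [coord, h]

theorem coord_ofCoord {c : ℂ × ℝ} (h : OnSphere c) : coord (ofCoord c) = c :=
  coord_toE3 (ofCoord_val h)

theorem ofCoord_coord (p : S2) : ofCoord (coord p) = p :=
  Subtype.ext ((ofCoord_val (onSphere_coord p)).trans (toE3_coord p))

theorem contMDiff_coord : ContMDiff (𝓡 2) 𝓘(ℝ, ℂ × ℝ) ∞ coord := by
  have h : ContDiff ℝ ∞ (fun u : E3 => ((⟨u 0, u 1⟩ : ℂ), u 2)) := by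
    have e : (fun u : E3 => ((⟨u 0, u 1⟩ : ℂ), u 2)) =
        fun u : E3 => ((u 0 : ℂ) + (u 1 : ℂ) * Complex.I, u 2) := by
      funext u
      rw [Complex.mk_eq_add_mul_I]
    rw [e]
    have hr : ∀ i : Fin 3, ContDiff ℝ ∞ (fun u : E3 => ((u i : ℝ) : ℂ)) := fun i =>
      Complex.ofRealCLM.contDiff.comp (by fun_prop)
    exact ((hr 0).add ((hr 1).mul contDiff_const)).prodMk (by fun_prop)
  exact h.contMDiff.comp contMDiff_val

/-- The coordinates of a point of `S² × S²`. -/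
def coords (q : S2 × S2) : (ℂ × ℝ) × (ℂ × ℝ) := (coord q.1, coord q.2)

/-- The point of `S² × S²` with given coordinates. -/
def ofCoords (c : (ℂ × ℝ) × (ℂ × ℝ)) : S2 × S2 := (ofCoord c.1, ofCoord c.2)

theorem ofCoords_coords (q : S2 × S2) : ofCoords (coords q) = q :=
  Prod.ext (ofCoord_coord _) (ofCoord_coord _)

/-- Both pairs of coordinates satisfy the equation of the unit sphere. -/
def OnSpheres (c : (ℂ × ℝ) × (ℂ × ℝ)) : Prop := OnSphere c.1 ∧ OnSphere c.2

theorem onSpheres_coords (q : S2 × S2) : OnSpheres (coords q) :=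
  ⟨onSphere_coord _, onSphere_coord _⟩

theorem coords_ofCoords {c : (ℂ × ℝ) × (ℂ × ℝ)} (h : OnSpheres c) : coords (ofCoords c) = c :=
  Prod.ext (coord_ofCoord h.1) (coord_ofCoord h.2)

theorem contMDiff_coords : ContMDiff I22 𝓘(ℝ, (ℂ × ℝ) × (ℂ × ℝ)) ∞ coords :=
  (contMDiff_coord.comp contMDiff_fst).prodMk_space (contMDiff_coord.comp contMDiff_snd)

theorem contMDiff_of_val {E H N : Type*} [NormedAddCommGroup E] [NormedSpace ℝ E]
    [TopologicalSpace H] {J : ModelWithCorners ℝ E H} [TopologicalSpace N] [ChartedSpace H N]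
    [IsManifold J ∞ N] {f : N → S2 × S2}
    (h1 : ContMDiff J 𝓘(ℝ, E3) ∞ (fun z => ((f z).1 : E3)))
    (h2 : ContMDiff J 𝓘(ℝ, E3) ∞ (fun z => ((f z).2 : E3))) : ContMDiff J I22 ∞ f :=
  (h1.codRestrict_sphere (n := 2) fun z => (f z).1.2).prodMk
    (h2.codRestrict_sphere (n := 2) fun z => (f z).2.2)

/-- The moment map of the diagonal circle action. -/
def level (α : ℝ) (c : (ℂ × ℝ) × (ℂ × ℝ)) : ℝ := (α + 1) * c.1.2 + α * c.2.2

theorem continuous_level (α : ℝ) : Continuous (level α) := by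
  unfold level
  fun_prop

/-- A flow that is given in coordinates on an open set of levels of `K` and is the identity outside a
closed set of levels. -/
theorem exists_mem_Ham_of_local {α : ℝ} {K : (ℂ × ℝ) × (ℂ × ℝ) → ℝ}
    (hK : Continuous K) {O C : Set ℝ} (hO : IsOpen O) (hC : IsClosed C)
    (hCO : C ⊆ O) {F : S2 × S2 → ℝ} {g : ℝ → (ℂ × ℝ) × (ℂ × ℝ) → (ℂ × ℝ) × (ℂ × ℝ)}
    (hsm : ∀ t c, OnSpheres c → K c ∈ O →
      ContDiffAt ℝ ∞ (fun z : ℝ × (ℂ × ℝ) × (ℂ × ℝ) => g z.1 z.2) (t, c))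
    (hS : ∀ t c, OnSpheres c → K c ∈ O → OnSpheres (g t c))
    (hlev : ∀ t c, OnSpheres c → K c ∈ O → K (g t c) = K c)
    (h0 : ∀ c, OnSpheres c → K c ∈ O → g 0 c = c)
    (hadd : ∀ s t c, OnSpheres c → K c ∈ O → g (s + t) c = g s (g t c))
    (hid : ∀ t c, OnSpheres c → K c ∈ O → K c ∉ C → g t c = c)
    (hF : ∀ q, K (coords q) ∈ O → ContMDiffAt I22 𝓘(ℝ, ℝ) ∞ F q)
    (hF0 : ∀ q, K (coords q) ∉ C → F q = 0)
    (hham : ∀ c : ℝ → S2 × S2, MDifferentiable 𝓘(ℝ, ℝ) I22 c → K (coords (c 0)) ∈ O →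
      (∀ s, coords (c s) = g s (coords (c 0))) → SatisfiesHamilton (omega α) F c 0 1) :
    ∃ φ ∈ Ham (omega α), ∀ q, K (coords q) ∈ O → coords (φ q) = g 1 (coords q) := by
  classical
  -- The preimages of `O` and of the complement of `C` are open and cover everything, and by `hid`
  -- the two branches agree on their overlap. So smoothness and Hamilton's equation can be checked
  -- on each piece.
  set φ : ℝ → S2 × S2 → S2 × S2 := fun t q =>
    if K (coords q) ∈ O then ofCoords (g t (coords q)) else q with hφ
  have hin : ∀ {t q}, K (coords q) ∈ O → coords (φ t q) = g t (coords q) := fun {t q} hq => by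
    simp only [hφ, if_pos hq]
    exact coords_ofCoords (hS _ _ (onSpheres_coords q) hq)
  have hout : ∀ {t q}, K (coords q) ∉ C → φ t q = q := fun {t q} hq => by
    simp only [hφ]
    split_ifs with h
    · rw [hid _ _ (onSpheres_coords q) h hq, ofCoords_coords]
    · rfl
  have hKc : Continuous fun q : S2 × S2 => K (coords q) :=
    hK.comp contMDiff_coords.continuous
  have hφ0 : ∀ q, φ 0 q = q := fun q => by
    simp only [hφ]
    split_ifs with h
    · rw [h0 _ (onSpheres_coords q) h, ofCoords_coords]
    · rfl
  have hφadd : ∀ s t q, φ (s + t) q = φ s (φ t q) := fun s t q => by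
    by_cases h : K (coords q) ∈ O
    · have h' : K (coords (φ t q)) ∈ O := by
        rw [hin h, hlev _ _ (onSpheres_coords q) h]
        exact h
      rw [← ofCoords_coords (φ (s + t) q), ← ofCoords_coords (φ s (φ t q)), hin h, hin h', hin h,
        hadd _ _ _ (onSpheres_coords q) h]
    · have hn : K (coords q) ∉ C := fun hc => h (hCO hc)
      rw [hout hn, hout hn, hout hn]
  have hpair : ∀ (P : (ℂ × ℝ) × (ℂ × ℝ) → ℂ × ℝ) (p : S2 × S2 → S2), ContDiff ℝ ∞ P →
      (∀ q, coord (p q) = P (coords q)) →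
      ContMDiff (𝓘(ℝ, ℝ).prod I22) 𝓘(ℝ, E3) ∞
        (fun z : ℝ × (S2 × S2) => (p (φ z.1 z.2) : E3)) := by
    intro P p hP hp z
    have hs : ContMDiff (𝓘(ℝ, ℝ).prod I22) 𝓘(ℝ, (ℂ × ℝ) × (ℂ × ℝ)) ∞
        (fun z : ℝ × (S2 × S2) => coords z.2) := contMDiff_coords.comp contMDiff_snd
    have hKz : Continuous fun z : ℝ × (S2 × S2) => K (coords z.2) :=
      hKc.comp continuous_snd
    have hval : ∀ q, (p q : E3) = toE3 (P (coords q)) := fun q => by rw [← hp, toE3_coord]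
    by_cases h : K (coords z.2) ∈ O
    · have h1 : ContMDiffAt (𝓘(ℝ, ℝ).prod I22) 𝓘(ℝ, ℝ × (ℂ × ℝ) × (ℂ × ℝ)) ∞
          (fun z : ℝ × (S2 × S2) => (z.1, coords z.2)) z :=
        (contMDiff_fst.prodMk_space hs) z
      have h2 := ((contDiff_toE3.comp hP).contDiffAt.comp (z.1, coords z.2)
        (hsm z.1 _ (onSpheres_coords z.2) h)).comp_contMDiffAt (f := fun z : ℝ × (S2 × S2) =>
          (z.1, coords z.2)) (x := z) h1
      refine h2.congr_of_eventuallyEq ?_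
      filter_upwards [hKz.continuousAt.preimage_mem_nhds (hO.mem_nhds h)] with y hy
      rw [hval, hin hy]
      rfl
    · have hn : K (coords z.2) ∉ C := fun hc => h (hCO hc)
      have h2 : ContMDiffAt (𝓘(ℝ, ℝ).prod I22) 𝓘(ℝ, E3) ∞
          (fun z : ℝ × (S2 × S2) => toE3 (P (coords z.2))) z :=
        (contDiff_toE3.comp hP).contDiffAt.comp_contMDiffAt (hs z)
      refine h2.congr_of_eventuallyEq ?_
      filter_upwards [hKz.continuousAt.preimage_mem_nhds (hC.isOpen_compl.mem_nhds hn)] with y hy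
      rw [hval, hout hy]
  have hφs : ContMDiff (𝓘(ℝ, ℝ).prod I22) I22 ∞ (fun z : ℝ × (S2 × S2) => φ z.1 z.2) :=
    contMDiff_of_val (hpair Prod.fst Prod.fst contDiff_fst fun _ => rfl)
      (hpair Prod.snd Prod.snd contDiff_snd fun _ => rfl)
  have hFev : ∀ q, K (coords q) ∉ C → F =ᶠ[𝓝 q] fun _ => 0 := fun q hq => by
    filter_upwards [hKc.continuousAt.preimage_mem_nhds (hC.isOpen_compl.mem_nhds hq)] with y hy
    exact hF0 y hy
  have hFs : ContMDiff I22 𝓘(ℝ, ℝ) ∞ F := fun q => by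
    by_cases h : K (coords q) ∈ O
    · exact hF q h
    · exact contMDiffAt_const.congr_of_eventuallyEq (hFev q fun hc => h (hCO hc))
  obtain ⟨Φ, hΦ, hΦφ⟩ := exists_isHamiltonianFlow_of_group (Ω := omega α) hFs hφs hφ0 hφadd
    (fun q => by
      have hd : MDifferentiable 𝓘(ℝ, ℝ) I22 (fun s => φ s q) :=
        (hφs.comp (contMDiff_id.prodMk contMDiff_const)).mdifferentiable (by simp)
      by_cases h : K (coords q) ∈ O
      · refine hham _ hd (by rwa [hφ0]) fun s => ?_
        rw [hφ0, hin h]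
      · have hn : K (coords q) ∉ C := fun hc => h (hCO hc)
        have hc : (fun s => φ s q) = fun _ => q := funext fun s => hout hn
        rw [hc]
        intro v
        have h1 : mfderiv 𝓘(ℝ, ℝ) I22 (fun _ : ℝ => q) 0 = 0 := mfderiv_const
        have h2 : mvfderiv I22 F q = 0 := by
          rw [mvfderiv, (hFev q hn).mfderiv_eq, mfderiv_const]
          exact ContinuousLinearMap.comp_zero _
        rw [h1, h2]
        exact (LinearMap.map_zero₂ (omega α q) v).trans (mul_zero _).symm)
  refine ⟨Φ 1, ⟨_, Φ, hΦ, rfl⟩, fun q hq => ?_⟩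
  rw [hΦφ, hin hq]

end Coordinates

/-! ### Hamiltonians invariant under the diagonal circle action. -/

section InvariantHamiltonians

/-- The cross product of the gradient of `κ · γ · δ · Im (conj w₁ * w₂)` in the first point with
the first point, with `k₀, k₁` the values of `κ` and its derivative, and so on. -/
def fieldFst (α k₀ k₁ g₀ g₁ d₀ : ℝ) (c : (ℂ × ℝ) × (ℂ × ℝ)) : ℂ × ℝ :=
  (((k₁ * (α + 1) * (g₀ * d₀ * (star c.1.1 * c.2.1).im) : ℝ) : ℂ) * Complex.I * c.1.1
    - ((k₀ * g₀ * d₀ * c.1.2 : ℝ) : ℂ) * c.2.1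
    + ((k₀ * g₁ * d₀ * (star c.1.1 * c.2.1).im : ℝ) : ℂ) * Complex.I * c.1.1,
    k₀ * g₀ * d₀ * (star c.1.1 * c.2.1).re)

/-- The cross product of the gradient of `κ · γ · δ · Im (conj w₁ * w₂)` in the second point with
the second point. -/
def fieldSnd (α k₀ k₁ g₀ d₀ d₁ : ℝ) (c : (ℂ × ℝ) × (ℂ × ℝ)) : ℂ × ℝ :=
  (((k₁ * α * (g₀ * d₀ * (star c.1.1 * c.2.1).im) : ℝ) : ℂ) * Complex.I * c.2.1
    + ((k₀ * g₀ * d₀ * c.2.2 : ℝ) : ℂ) * c.1.1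
    + ((k₀ * g₀ * d₁ * (star c.1.1 * c.2.1).im : ℝ) : ℂ) * Complex.I * c.2.1,
    -(k₀ * g₀ * d₀ * (star c.1.1 * c.2.1).re))

theorem toE3_smul (r : ℝ) (c : ℂ × ℝ) : toE3 (r • c) = r • toE3 c := by
  ext i
  fin_cases i <;> simp [toE3]

/-- The Hamiltonian `κ(K) γ(h₁) δ(h₂) Im (conj w₁ * w₂)`, invariant under the diagonal circle
action with moment map `K`, on pairs of vectors of Euclidean three-space. -/
def invariantHam (α : ℝ) (κ γ δ : ℝ → ℝ) (z : E3 × E3) : ℝ :=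
  κ ((α + 1) * z.1 2 + α * z.2 2) *
    (γ (z.1 2) * δ (z.2 2) * (z.1 0 * z.2 1 - z.1 1 * z.2 0))

theorem contDiffAt_invariantHam {α : ℝ} {κ γ δ : ℝ → ℝ} {z : E3 × E3} (hκ : ContDiff ℝ ∞ κ)
    (hγ : ContDiffAt ℝ ∞ γ (z.1 2)) (hδ : ContDiffAt ℝ ∞ δ (z.2 2)) :
    ContDiffAt ℝ ∞ (invariantHam α κ γ δ) z := by
  have h1 : ∀ i : Fin 3, ContDiff ℝ ∞ (fun z : E3 × E3 => z.1 i) := fun i => by fun_prop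
  have h2 : ∀ i : Fin 3, ContDiff ℝ ∞ (fun z : E3 × E3 => z.2 i) := fun i => by fun_prop
  unfold invariantHam
  exact (hκ.comp ((contDiff_const.mul (h1 2)).add (contDiff_const.mul (h2 2)))).contDiffAt.mul
    (((hγ.comp z (h1 2).contDiffAt).mul (hδ.comp z (h2 2).contDiffAt)).mul
      (((h1 0).mul (h2 1)).sub ((h1 1).mul (h2 0))).contDiffAt)

/-- For a unit vector `u` and `v ⊥ u`, a gradient `G` satisfies `det (u, G × u, v) = G · v`. The
scalings by `2π / (α + 1)` and `2π / α` cancel the weights of the area forms. -/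
theorem hasDerivAt_invariantHam {α k₁ g₁ d₁ : ℝ} {κ γ δ : ℝ → ℝ} {u p v w : E3} (hα : 0 < α)
    (hu : OnSphere (⟨u 0, u 1⟩, u 2)) (hp : OnSphere (⟨p 0, p 1⟩, p 2))
    (hκ : HasDerivAt κ k₁ ((α + 1) * u 2 + α * p 2))
    (hγ : HasDerivAt γ g₁ (u 2)) (hδ : HasDerivAt δ d₁ (p 2))
    (hv : inner ℝ u v = 0) (hw : inner ℝ p w = 0) :
    HasDerivAt (fun s : ℝ => invariantHam α κ γ δ (u + s • v, p + s • w))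
      ((α + 1) / (2 * Real.pi) * tripleProduct u (toE3 ((2 * Real.pi / (α + 1)) •
          fieldFst α (κ ((α + 1) * u 2 + α * p 2)) k₁ (γ (u 2)) g₁ (δ (p 2))
            ((⟨u 0, u 1⟩, u 2), (⟨p 0, p 1⟩, p 2)))) v +
        α / (2 * Real.pi) * tripleProduct p (toE3 ((2 * Real.pi / α) •
          fieldSnd α (κ ((α + 1) * u 2 + α * p 2)) k₁ (γ (u 2)) (δ (p 2)) d₁
            ((⟨u 0, u 1⟩, u 2), (⟨p 0, p 1⟩, p 2)))) w) 0 := by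
  have e : ∀ (x y : E3) (i : Fin 3), HasDerivAt (fun s : ℝ => (x + s • y) i) (y i) 0 := by
    intro x y i
    simpa using ((hasDerivAt_id (0 : ℝ)).mul_const (y i)).const_add (x i)
  have z : ∀ (x y : E3) (i : Fin 3), x i = (x + (0 : ℝ) • y) i := by simp
  have hγ' := HasDerivAt.comp (0 : ℝ) (h₂ := γ) (h₂' := g₁) (by rw [← z]; exact hγ) (e u v 2)
  have hδ' := HasDerivAt.comp (0 : ℝ) (h₂ := δ) (h₂' := d₁) (by rw [← z]; exact hδ) (e p w 2)
  have hκ' := HasDerivAt.comp (0 : ℝ) (h₂ := κ) (h₂' := k₁) (by simpa using hκ)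
    (((e u v 2).const_mul (α + 1)).add ((e p w 2).const_mul α))
  have key := hκ'.mul ((hγ'.mul hδ').mul
    (((e u v 0).mul (e p w 1)).sub ((e u v 1).mul (e p w 0))))
  refine key.congr_deriv ?_
  have hpi := Real.pi_pos
  have c1 : (α + 1) / (2 * Real.pi) * (2 * Real.pi / (α + 1)) = 1 := by
    field_simp
  have c2 : α / (2 * Real.pi) * (2 * Real.pi / α) = 1 := by
    field_simp
  rw [toE3_smul, toE3_smul, map_smul, map_smul, LinearMap.smul_apply, LinearMap.smul_apply,
    smul_eq_mul, smul_eq_mul, ← mul_assoc (_ / _) (2 * Real.pi / (α + 1)),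
    ← mul_assoc (_ / _) (2 * Real.pi / α), c1, c2, one_mul, one_mul,
    tripleProduct_apply, tripleProduct_apply]
  rw [inner_E3] at hv hw
  simp only [OnSphere, Complex.normSq_mk] at hu hp
  simp only [Function.comp_apply, Pi.mul_apply, Pi.add_apply, Pi.sub_apply, ← z, toE3_zero,
    toE3_one, toE3_two, fieldFst, fieldSnd,
    Complex.add_re, Complex.sub_re, Complex.mul_re, Complex.add_im, Complex.sub_im, Complex.mul_im,
    Complex.ofReal_re, Complex.ofReal_im, Complex.I_re, Complex.I_im, Complex.star_def,
    Complex.conj_re, Complex.conj_im]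
  generalize κ ((α + 1) * u 2 + α * p 2) = k₀
  generalize γ (u 2) = g₀
  generalize δ (p 2) = d₀
  set J := u 0 * p 1 - u 1 * p 0 with hJ
  set X2 := k₁ * (α + 1) * (g₀ * d₀ * J) + k₀ * g₁ * d₀ * J with hX2
  set Y2 := k₁ * α * (g₀ * d₀ * J) + k₀ * g₀ * d₁ * J with hY2
  -- Each factor contributes `u × (G × u) = |u|² G - (u · G) u` paired with `v`: the coefficients
  -- are `-G · v` for `|u|² = 1` and `G · u` for `u · v = 0`.
  linear_combination
    (-(k₀ * g₀ * d₀ * p 1 * v 0 - k₀ * g₀ * d₀ * p 0 * v 1 + X2 * v 2)) * hu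
    + (k₀ * g₀ * d₀ * J + X2 * u 2) * hv
    + (-(-(k₀ * g₀ * d₀ * u 1 * w 0) + k₀ * g₀ * d₀ * u 0 * w 1 + Y2 * w 2)) * hp
    + (k₀ * g₀ * d₀ * J + Y2 * p 2) * hw

/-- A flow given in coordinates by the vector field of an invariant Hamiltonian. -/
theorem exists_mem_Ham_of_invariant {α : ℝ} (hα : 0 < α) {O : Set ℝ} (hO : IsOpen O)
    {κ γ δ : ℝ → ℝ} (hκ : ContDiff ℝ ∞ κ) (hκO : tsupport κ ⊆ O)
    {g : ℝ → (ℂ × ℝ) × (ℂ × ℝ) → (ℂ × ℝ) × (ℂ × ℝ)}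
    (hγ : ∀ c, OnSpheres c → level α c ∈ O → ContDiffAt ℝ ∞ γ c.1.2)
    (hδ : ∀ c, OnSpheres c → level α c ∈ O → ContDiffAt ℝ ∞ δ c.2.2)
    (hsm : ∀ t c, OnSpheres c → level α c ∈ O →
      ContDiffAt ℝ ∞ (fun z : ℝ × (ℂ × ℝ) × (ℂ × ℝ) => g z.1 z.2) (t, c))
    (hS : ∀ t c, OnSpheres c → level α c ∈ O → OnSpheres (g t c))
    (hlev : ∀ t c, OnSpheres c → level α c ∈ O → level α (g t c) = level α c)
    (h0 : ∀ c, OnSpheres c → level α c ∈ O → g 0 c = c)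
    (hadd : ∀ s t c, OnSpheres c → level α c ∈ O → g (s + t) c = g s (g t c))
    (hid : ∀ t c, OnSpheres c → level α c ∈ O → level α c ∉ tsupport κ → g t c = c)
    (hder : ∀ c, OnSpheres c → level α c ∈ O → HasDerivAt (fun s => g s c)
      ((2 * Real.pi / (α + 1)) • fieldFst α (κ (level α c)) (deriv κ (level α c)) (γ c.1.2)
          (deriv γ c.1.2) (δ c.2.2) c,
        (2 * Real.pi / α) • fieldSnd α (κ (level α c)) (deriv κ (level α c)) (γ c.1.2)
          (δ c.2.2) (deriv δ c.2.2) c) 0) :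
    ∃ φ ∈ Ham (omega α), ∀ q, level α (coords q) ∈ O → coords (φ q) = g 1 (coords q) := by
  have hsmooth : ∀ q : S2 × S2, level α (coords q) ∈ O →
      ContDiffAt ℝ ∞ (invariantHam α κ γ δ) ((q.1 : E3), (q.2 : E3)) := fun q hq =>
    contDiffAt_invariantHam hκ (hγ _ (onSpheres_coords q) hq) (hδ _ (onSpheres_coords q) hq)
  refine exists_mem_Ham_of_local (continuous_level α) hO (isClosed_tsupport κ) hκO
    (F := fun q => invariantHam α κ γ δ (q.1, q.2)) hsm hS hlev h0 hadd hid (fun q hq => ?_)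
    (fun q hq => ?_) (fun c hc h0O hcs => ?_)
  · exact (hsmooth q hq).comp_contMDiffAt (f := fun q : S2 × S2 => ((q.1 : E3), (q.2 : E3)))
      ((contMDiff_val_fst.prodMk_space contMDiff_val_snd) q)
  · have : κ (level α (coords q)) = 0 := image_eq_zero_of_notMem_tsupport hq
    change κ (level α (coords q)) * _ = 0
    rw [this, zero_mul]
  · have hon := onSpheres_coords (c 0)
    have hd := hder _ hon h0O
    have hval1 : (fun s => ((c s).1 : E3)) = fun s => toE3 (g s (coords (c 0))).1 := by
      funext s
      rw [← hcs, coords, toE3_coord]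
    have hval2 : (fun s => ((c s).2 : E3)) = fun s => toE3 (g s (coords (c 0))).2 := by
      funext s
      rw [← hcs, coords, toE3_coord]
    have hpair : ∀ {P : (ℂ × ℝ) × (ℂ × ℝ) →L[ℝ] ℂ × ℝ} {x : (ℂ × ℝ) × (ℂ × ℝ)},
        HasDerivAt (fun s => g s (coords (c 0))) x 0 →
        HasDerivAt (fun s => toE3 (P (g s (coords (c 0))))) (toE3 (P x)) 0 := by
      intro P x hx
      have hP := P.hasFDerivAt.comp_hasDerivAt (0 : ℝ) hx
      exact hasDerivAt_toE3
        ((ContinuousLinearMap.fst ℝ ℂ ℝ).hasFDerivAt.comp_hasDerivAt (0 : ℝ) hP)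
        ((ContinuousLinearMap.snd ℝ ℂ ℝ).hasFDerivAt.comp_hasDerivAt (0 : ℝ) hP)
    refine satisfiesHamilton_of_hasDerivAt (Ft := invariantHam α κ γ δ) (hc 0)
      (by rw [hval1]; exact hpair (P := ContinuousLinearMap.fst ℝ _ _) hd)
      (by rw [hval2]; exact hpair (P := ContinuousLinearMap.snd ℝ _ _) hd)
      Filter.EventuallyEq.rfl ((hsmooth _ h0O).differentiableAt (by simp)) fun v w hv hw => ?_
    exact hasDerivAt_invariantHam hα hon.1 hon.2
      ((hκ.differentiable (by simp)) _).hasDerivAt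
      ((hγ _ hon h0O).differentiableAt (by simp)).hasDerivAt
      ((hδ _ hon h0O).differentiableAt (by simp)).hasDerivAt hv hw

end InvariantHamiltonians

/-! ### Levels in `(-1, 1)`: a half turn of the reduced sphere. -/

section Annulus

/-- The radius of the circle of height `h` on the unit sphere. -/
def radius (h : ℝ) : ℝ := Real.sqrt (1 - h ^ 2)

theorem radius_pos {h : ℝ} (hh : 0 < 1 - h ^ 2) : 0 < radius h := Real.sqrt_pos.2 hh

theorem radius_sq {h : ℝ} (hh : 0 < 1 - h ^ 2) : radius h ^ 2 = 1 - h ^ 2 := Real.sq_sqrt hh.le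

theorem contDiffAt_radius {h : ℝ} (hh : 0 < 1 - h ^ 2) : ContDiffAt ℝ ∞ radius h :=
  (Real.contDiffAt_sqrt hh.ne').comp h (f := fun h : ℝ => 1 - h ^ 2) (by fun_prop)

theorem hasDerivAt_radius {h : ℝ} (hh : 0 < 1 - h ^ 2) :
    HasDerivAt radius (-h / radius h) h := by
  have h1 : HasDerivAt (fun h : ℝ => 1 - h ^ 2) (-(2 * h)) h := by
    simpa using (hasDerivAt_pow 2 h).const_sub 1
  refine (h1.sqrt hh.ne').congr_deriv ?_
  change -(2 * h) / (2 * radius h) = _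
  have := (radius_pos hh).ne'
  field_simp

theorem _root_.ContDiffAt.complex_ofReal {E : Type*} [NormedAddCommGroup E] [NormedSpace ℝ E] {f : E → ℝ}
    {x : E} (hf : ContDiffAt ℝ ∞ f x) : ContDiffAt ℝ ∞ (fun y => (f y : ℂ)) x :=
  Complex.ofRealCLM.contDiff.contDiffAt.comp x hf

theorem _root_.ContDiffAt.complex_re {E : Type*} [NormedAddCommGroup E] [NormedSpace ℝ E] {f : E → ℂ}
    {x : E} (hf : ContDiffAt ℝ ∞ f x) : ContDiffAt ℝ ∞ (fun y => (f y).re) x :=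
  Complex.reCLM.contDiff.contDiffAt.comp x hf

theorem _root_.ContDiffAt.complex_im {E : Type*} [NormedAddCommGroup E] [NormedSpace ℝ E] {f : E → ℂ}
    {x : E} (hf : ContDiffAt ℝ ∞ f x) : ContDiffAt ℝ ∞ (fun y => (f y).im) x :=
  Complex.imCLM.contDiff.contDiffAt.comp x hf

theorem _root_.ContDiffAt.complex_star {E : Type*} [NormedAddCommGroup E] [NormedSpace ℝ E] {f : E → ℂ}
    {x : E} (hf : ContDiffAt ℝ ∞ f x) : ContDiffAt ℝ ∞ (fun y => star (f y)) x :=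
  Complex.conjCLE.contDiff.contDiffAt.comp x hf

theorem contDiff_level (α : ℝ) : ContDiff ℝ ∞ (level α) := by
  unfold level
  fun_prop

/-- The direction of the horizontal part of the first point. -/
def phase (c : (ℂ × ℝ) × (ℂ × ℝ)) : ℂ := ((radius c.1.2)⁻¹ : ℝ) * c.1.1

/-- The horizontal part of the second point, rotated back by the phase of the first point. -/
def rotated (c : (ℂ × ℝ) × (ℂ × ℝ)) : ℂ := star (phase c) * c.2.1

/-- The pair of points at level `k` whose first point has phase `ζ` and whose second point, rotated
back by `ζ`, is `(x, z, y)`. -/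
def annulusChart (α k : ℝ) (ζ : ℂ) (x z y : ℝ) : (ℂ × ℝ) × (ℂ × ℝ) :=
  (((radius ((k - α * y) / (α + 1)) : ℝ) * ζ, (k - α * y) / (α + 1)),
    (ζ * (x + z * Complex.I), y))

variable {α k x z y : ℝ} {ζ : ℂ}

theorem level_annulusChart (hα : 0 < α) : level α (annulusChart α k ζ x z y) = k := by
  simp only [level, annulusChart]
  field_simp
  ring

theorem phase_annulusChart (hh : 0 < 1 - ((k - α * y) / (α + 1)) ^ 2) :
    phase (annulusChart α k ζ x z y) = ζ := by
  simp only [phase, annulusChart]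
  rw [← mul_assoc, ← Complex.ofReal_mul, inv_mul_cancel₀ (radius_pos hh).ne', Complex.ofReal_one,
    one_mul]

theorem star_mul_self_eq_one (hζ : Complex.normSq ζ = 1) : star ζ * ζ = 1 := by
  rw [Complex.star_def, ← Complex.normSq_eq_conj_mul_self, hζ, Complex.ofReal_one]

theorem rotated_annulusChart (hζ : Complex.normSq ζ = 1)
    (hh : 0 < 1 - ((k - α * y) / (α + 1)) ^ 2) :
    rotated (annulusChart α k ζ x z y) = x + z * Complex.I := by
  rw [rotated, phase_annulusChart hh, annulusChart, ← mul_assoc, star_mul_self_eq_one hζ, one_mul]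

theorem onSpheres_annulusChart (hζ : Complex.normSq ζ = 1)
    (hh : 0 < 1 - ((k - α * y) / (α + 1)) ^ 2) (hq : x ^ 2 + z ^ 2 + y ^ 2 = 1) :
    OnSpheres (annulusChart α k ζ x z y) := by
  constructor
  · simp only [OnSphere, annulusChart, Complex.normSq_mul, hζ, Complex.normSq_ofReal]
    nlinarith [radius_sq hh]
  · simp only [OnSphere, annulusChart, Complex.normSq_mul, hζ, Complex.normSq_add_mul_I]
    linarith

/-- From `|k| < 1` and `|α y| ≤ α` one gets `|k - α y| < α + 1`: on these levels the first point is
not a pole, so its phase is defined. -/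
theorem one_sub_sq_pos_of_level (hα : 0 < α) (hy : y ^ 2 ≤ 1) (hk : k ∈ Set.Ioo (-1 : ℝ) 1) :
    0 < 1 - ((k - α * y) / (α + 1)) ^ 2 := by
  have hy' := abs_le.1 ((sq_le_one_iff_abs_le_one y).1 hy)
  have h1 : |(k - α * y) / (α + 1)| < 1 := by
    rw [abs_lt, lt_div_iff₀ (by linarith), div_lt_iff₀ (by linarith)]
    constructor <;> nlinarith [hk.1, hk.2, hy'.1, hy'.2]
  have := (sq_lt_one_iff_abs_lt_one _).2 h1
  linarith

theorem OnSphere.height_sq_le {c : ℂ × ℝ} (h : OnSphere c) : c.2 ^ 2 ≤ 1 := by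
  have := Complex.normSq_nonneg c.1
  unfold OnSphere at h
  linarith

theorem height_eq_of_level (hα : 0 < α) (c : (ℂ × ℝ) × (ℂ × ℝ)) :
    (level α c - α * c.2.2) / (α + 1) = c.1.2 := by
  unfold level
  field_simp
  ring

theorem one_sub_height_sq_pos (hα : 0 < α) {c : (ℂ × ℝ) × (ℂ × ℝ)} (hc : OnSpheres c)
    (hk : level α c ∈ Set.Ioo (-1 : ℝ) 1) : 0 < 1 - c.1.2 ^ 2 := by
  rw [← height_eq_of_level hα c]
  exact one_sub_sq_pos_of_level hα hc.2.height_sq_le hk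

theorem normSq_phase (hα : 0 < α) {c : (ℂ × ℝ) × (ℂ × ℝ)} (hc : OnSpheres c)
    (hk : level α c ∈ Set.Ioo (-1 : ℝ) 1) : Complex.normSq (phase c) = 1 := by
  have hh := one_sub_height_sq_pos hα hc hk
  have h1 := hc.1
  unfold OnSphere at h1
  rw [phase, Complex.normSq_mul, Complex.normSq_ofReal, ← mul_inv, ← sq, radius_sq hh]
  rw [inv_mul_eq_one₀ hh.ne']
  linarith

theorem normSq_rotated (hα : 0 < α) {c : (ℂ × ℝ) × (ℂ × ℝ)} (hc : OnSpheres c)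
    (hk : level α c ∈ Set.Ioo (-1 : ℝ) 1) :
    (rotated c).re ^ 2 + (rotated c).im ^ 2 + c.2.2 ^ 2 = 1 := by
  have h1 : Complex.normSq (rotated c) = Complex.normSq c.2.1 := by
    rw [rotated, Complex.normSq_mul, Complex.star_def, Complex.normSq_conj, normSq_phase hα hc hk,
      one_mul]
  have h2 := hc.2
  unfold OnSphere at h2
  rw [← h1, Complex.normSq_apply] at h2
  linarith

theorem annulusChart_self (hα : 0 < α) {c : (ℂ × ℝ) × (ℂ × ℝ)} (hc : OnSpheres c)
    (hk : level α c ∈ Set.Ioo (-1 : ℝ) 1) :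
    annulusChart α (level α c) (phase c) (rotated c).re (rotated c).im c.2.2 = c := by
  have hh := one_sub_height_sq_pos hα hc hk
  have h1 := star_mul_self_eq_one (normSq_phase hα hc hk)
  refine Prod.ext (Prod.ext ?_ (height_eq_of_level hα c)) (Prod.ext ?_ rfl)
  · simp only [annulusChart]
    rw [height_eq_of_level hα c, phase, ← mul_assoc, ← Complex.ofReal_mul,
      mul_inv_cancel₀ (radius_pos hh).ne', Complex.ofReal_one, one_mul]
  · simp only [annulusChart]
    rw [Complex.re_add_im, rotated, ← mul_assoc, mul_comm (phase c), h1, one_mul]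

/-- The flow of an invariant Hamiltonian that rotates the reduced spheres of the levels in
`(-1, 1)`. -/
def annulusFlow (α : ℝ) (κ : ℝ → ℝ) (t : ℝ) (c : (ℂ × ℝ) × (ℂ × ℝ)) : (ℂ × ℝ) × (ℂ × ℝ) :=
  annulusChart α (level α c)
    (Complex.exp ((2 * Real.pi * deriv κ (level α c) * α * (rotated c).im * t : ℝ) * Complex.I) *
      phase c)
    (Real.cos (2 * Real.pi * κ (level α c) * t) * (rotated c).re +
      Real.sin (2 * Real.pi * κ (level α c) * t) * c.2.2)
    (rotated c).im
    (Real.cos (2 * Real.pi * κ (level α c) * t) * c.2.2 -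
      Real.sin (2 * Real.pi * κ (level α c) * t) * (rotated c).re)

theorem normSq_exp_mul_I_mul (θ : ℝ) (ζ : ℂ) :
    Complex.normSq (Complex.exp (θ * Complex.I) * ζ) = Complex.normSq ζ := by
  rw [Complex.normSq_mul, Complex.normSq_eq_norm_sq, Complex.norm_exp_ofReal_mul_I]
  simp

theorem rotation_sq (θ x y : ℝ) :
    (Real.cos θ * x + Real.sin θ * y) ^ 2 + (Real.cos θ * y - Real.sin θ * x) ^ 2 =
      x ^ 2 + y ^ 2 := by
  linear_combination (x ^ 2 + y ^ 2) * Real.cos_sq_add_sin_sq θ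

variable {κ : ℝ → ℝ} {c : (ℂ × ℝ) × (ℂ × ℝ)}

theorem annulusFlow_radius_pos (hα : 0 < α) (hc : OnSpheres c)
    (hk : level α c ∈ Set.Ioo (-1 : ℝ) 1) (θ : ℝ) :
    0 < 1 - ((level α c - α * (Real.cos θ * c.2.2 - Real.sin θ * (rotated c).re)) / (α + 1)) ^ 2 := by
  refine one_sub_sq_pos_of_level hα ?_ hk
  nlinarith [rotation_sq θ (rotated c).re c.2.2, normSq_rotated hα hc hk,
    sq_nonneg (rotated c).im, sq_nonneg (Real.cos θ * (rotated c).re + Real.sin θ * c.2.2)]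

/-- The level and the imaginary part of `rotated c` are conserved. The rotation angle per unit time
and the phase speed depend on these alone, so angles and phases add up. -/
theorem annulusFlow_add (hα : 0 < α) (hc : OnSpheres c)
    (hk : level α c ∈ Set.Ioo (-1 : ℝ) 1) (s t : ℝ) :
    annulusFlow α κ (s + t) c = annulusFlow α κ s (annulusFlow α κ t c) := by
  have h1 := annulusFlow_radius_pos hα hc hk (2 * Real.pi * κ (level α c) * t)
  have hlev : level α (annulusFlow α κ t c) = level α c := level_annulusChart hα
  have hph := phase_annulusChart (x := Real.cos (2 * Real.pi * κ (level α c) * t) * (rotated c).re +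
      Real.sin (2 * Real.pi * κ (level α c) * t) * c.2.2) (z := (rotated c).im)
      (ζ := Complex.exp ((2 * Real.pi * deriv κ (level α c) * α * (rotated c).im * t : ℝ) *
        Complex.I) * phase c) h1
  have hrot := rotated_annulusChart
    (x := Real.cos (2 * Real.pi * κ (level α c) * t) * (rotated c).re +
      Real.sin (2 * Real.pi * κ (level α c) * t) * c.2.2) (z := (rotated c).im)
      (ζ := Complex.exp ((2 * Real.pi * deriv κ (level α c) * α * (rotated c).im * t : ℝ) *
        Complex.I) * phase c) (by rw [normSq_exp_mul_I_mul, normSq_phase hα hc hk]) h1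
  change phase (annulusFlow α κ t c) = _ at hph
  change rotated (annulusFlow α κ t c) = _ at hrot
  have hre := congrArg Complex.re hrot
  have him := congrArg Complex.im hrot
  simp only [Complex.add_re, Complex.ofReal_re, Complex.mul_re, Complex.I_re, Complex.I_im,
    Complex.ofReal_im, Complex.add_im, Complex.mul_im, mul_zero, mul_one, sub_zero,
    add_zero, zero_add] at hre him
  conv_rhs => rw [annulusFlow, hlev, hph, hre, him]
  rw [annulusFlow, mul_add, mul_add, Real.cos_add, Real.sin_add, Complex.ofReal_add, add_mul,
    Complex.exp_add, ← mul_assoc]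
  simp only [annulusFlow, annulusChart]
  congr 1 <;> ring_nf

theorem contDiffAt_annulusFlow (hα : 0 < α) (hκ : ContDiff ℝ ∞ κ) (hc : OnSpheres c)
    (hk : level α c ∈ Set.Ioo (-1 : ℝ) 1) (t : ℝ) :
    ContDiffAt ℝ ∞ (fun z : ℝ × (ℂ × ℝ) × (ℂ × ℝ) => annulusFlow α κ z.1 z.2) (t, c) := by
  have hh := one_sub_height_sq_pos hα hc hk
  have h1 := annulusFlow_radius_pos hα hc hk (2 * Real.pi * κ (level α c) * t)
  have ht : ContDiffAt ℝ ∞ (fun z : ℝ × (ℂ × ℝ) × (ℂ × ℝ) => z.1) (t, c) := contDiffAt_fst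
  have hl : ContDiffAt ℝ ∞ (fun z : ℝ × (ℂ × ℝ) × (ℂ × ℝ) => level α z.2) (t, c) :=
    ((contDiff_level α).comp contDiff_snd).contDiffAt
  have hw : ContDiffAt ℝ ∞ (fun z : ℝ × (ℂ × ℝ) × (ℂ × ℝ) => z.2.1.1) (t, c) := by fun_prop
  have hv : ContDiffAt ℝ ∞ (fun z : ℝ × (ℂ × ℝ) × (ℂ × ℝ) => z.2.2.1) (t, c) := by fun_prop
  have hhh : ContDiffAt ℝ ∞ (fun z : ℝ × (ℂ × ℝ) × (ℂ × ℝ) => z.2.1.2) (t, c) := by fun_prop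
  have hy : ContDiffAt ℝ ∞ (fun z : ℝ × (ℂ × ℝ) × (ℂ × ℝ) => z.2.2.2) (t, c) := by fun_prop
  have hr : ContDiffAt ℝ ∞ (fun z : ℝ × (ℂ × ℝ) × (ℂ × ℝ) => (radius z.2.1.2)⁻¹) (t, c) :=
    ContDiffAt.inv (f := fun z : ℝ × (ℂ × ℝ) × (ℂ × ℝ) => radius z.2.1.2)
      (ContDiffAt.comp (t, c) (g := radius) (contDiffAt_radius hh) hhh) (radius_pos hh).ne'
  have hp : ContDiffAt ℝ ∞ (fun z : ℝ × (ℂ × ℝ) × (ℂ × ℝ) => phase z.2) (t, c) :=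
    hr.complex_ofReal.mul hw
  have hq : ContDiffAt ℝ ∞ (fun z : ℝ × (ℂ × ℝ) × (ℂ × ℝ) => rotated z.2) (t, c) :=
    hp.complex_star.mul hv
  have hκl := hκ.contDiffAt.comp (t, c) hl
  have hκ'l := (contDiff_infty_iff_deriv.1 hκ).2.contDiffAt.comp (t, c) hl
  have hθ : ContDiffAt ℝ ∞ (fun z : ℝ × (ℂ × ℝ) × (ℂ × ℝ) =>
      2 * Real.pi * κ (level α z.2) * z.1) (t, c) := (contDiffAt_const.mul hκl).mul ht
  have hcos := Real.contDiff_cos.contDiffAt.comp (t, c) hθ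
  have hsin := Real.contDiff_sin.contDiffAt.comp (t, c) hθ
  have hyt := (hcos.mul hy).sub (hsin.mul hq.complex_re)
  have hxt := (hcos.mul hq.complex_re).add (hsin.mul hy)
  have hht := (hl.sub (contDiffAt_const (c := α) |>.mul hyt)).div_const (α + 1)
  have hrt := (contDiffAt_radius h1).comp (t, c) hht
  have hexp : ContDiffAt ℝ ∞ (fun z : ℝ × (ℂ × ℝ) × (ℂ × ℝ) =>
      Complex.exp ((2 * Real.pi * deriv κ (level α z.2) * α * (rotated z.2).im * z.1 : ℝ) *
        Complex.I)) (t, c) :=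
    (ContDiffAt.mul (ContDiffAt.complex_ofReal ((((contDiffAt_const.mul hκ'l).mul
      contDiffAt_const).mul hq.complex_im).mul ht)) contDiffAt_const).cexp
  have hζ := hexp.mul hp
  exact ((hrt.complex_ofReal.mul hζ).prodMk hht).prodMk ((hζ.mul (hxt.complex_ofReal.add
    (hq.complex_im.complex_ofReal.mul contDiffAt_const))).prodMk hyt)

theorem hasDerivAt_inv_radius {h : ℝ} (hh : 0 < 1 - h ^ 2) :
    HasDerivAt (fun h => (radius h)⁻¹) (h / radius h ^ 3) h := by
  have hr := (radius_pos hh).ne'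
  refine ((hasDerivAt_radius hh).inv hr).congr_deriv ?_
  field_simp

theorem hasDerivAt_exp_mul_I (b : ℝ) :
    HasDerivAt (fun t : ℝ => Complex.exp ((b * t : ℝ) * Complex.I)) (b * Complex.I) 0 := by
  have h1 : HasDerivAt (fun t : ℝ => ((b * t : ℝ) : ℂ)) b 0 := by
    have := ((hasDerivAt_id (0 : ℝ)).const_mul b).ofReal_comp
    simpa using this
  simpa using (h1.mul_const Complex.I).cexp

theorem hasDerivAt_rotation (a x y : ℝ) :
    HasDerivAt (fun t : ℝ => Real.cos (a * t) * x + Real.sin (a * t) * y) (a * y) 0 := by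
  have h1 : HasDerivAt (fun t : ℝ => a * t) a 0 := by
    simpa using (hasDerivAt_id (0 : ℝ)).const_mul a
  refine ((h1.cos.mul_const x).add (h1.sin.mul_const y)).congr_deriv ?_
  simp

/-- With `γ` the inverse radius and `δ = α`, the Hamiltonian is `κ(K) α z`, where `z` is the
imaginary part of the rotated second point. It turns the reduced sphere about the `z`-axis at speed
`2π κ(K)`; differentiating the cutoff gives the phase speed `2π κ'(K) α z`. -/
theorem hasDerivAt_annulusFlow (hα : 0 < α) (hc : OnSpheres c)
    (hk : level α c ∈ Set.Ioo (-1 : ℝ) 1) :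
    HasDerivAt (fun s => annulusFlow α κ s c)
      ((2 * Real.pi / (α + 1)) • fieldFst α (κ (level α c)) (deriv κ (level α c))
          (radius c.1.2)⁻¹ (deriv (fun h => (radius h)⁻¹) c.1.2) α c,
        (2 * Real.pi / α) • fieldSnd α (κ (level α c)) (deriv κ (level α c))
          (radius c.1.2)⁻¹ α (deriv (fun _ => α) c.2.2) c) 0 := by
  have hh := one_sub_height_sq_pos hα hc hk
  have hr := radius_pos hh
  have hζ := normSq_phase hα hc hk
  have hself := annulusChart_self hα hc hk
  have hw : c.1.1 = (radius c.1.2 : ℝ) * phase c := by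
    rw [phase, ← mul_assoc, ← Complex.ofReal_mul, mul_inv_cancel₀ hr.ne', Complex.ofReal_one,
      one_mul]
  have hv : c.2.1 = phase c * ((rotated c).re + (rotated c).im * Complex.I) := by
    rw [Complex.re_add_im, rotated, ← mul_assoc, mul_comm (phase c), star_mul_self_eq_one hζ,
      one_mul]
  have hwv : star c.1.1 * c.2.1 =
      (radius c.1.2 : ℝ) * ((rotated c).re + (rotated c).im * Complex.I) := by
    rw [Complex.re_add_im, rotated]
    conv_lhs => rw [hw]
    rw [star_mul', Complex.star_def, Complex.conj_ofReal]
    simp [mul_assoc]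
  have hre : (star c.1.1 * c.2.1).re = radius c.1.2 * (rotated c).re := by
    rw [hwv]; simp
  have him : (star c.1.1 * c.2.1).im = radius c.1.2 * (rotated c).im := by
    rw [hwv]; simp
  rw [(hasDerivAt_inv_radius hh).deriv, deriv_const]
  simp only [fieldFst, fieldSnd, hre, him]
  have hflow : (fun s => annulusFlow α κ s c) = fun s : ℝ => annulusChart α (level α c)
      (Complex.exp ((2 * Real.pi * deriv κ (level α c) * α * (rotated c).im * s : ℝ) *
        Complex.I) * phase c)
      (Real.cos (2 * Real.pi * κ (level α c) * s) * (rotated c).re +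
        Real.sin (2 * Real.pi * κ (level α c) * s) * c.2.2)
      (rotated c).im
      (Real.cos (2 * Real.pi * κ (level α c) * s) * c.2.2 -
        Real.sin (2 * Real.pi * κ (level α c) * s) * (rotated c).re) := rfl
  rw [hflow]
  set k := level α c with hkdef
  have hheight : (k - α * c.2.2) / (α + 1) = c.1.2 := height_eq_of_level hα c
  clear_value k
  set ρ := radius c.1.2 with hρ
  set ζ := phase c
  set x := (rotated c).re
  set z := (rotated c).im
  set a := 2 * Real.pi * κ k with ha
  set b := 2 * Real.pi * deriv κ k * α * z with hb
  have hyt : HasDerivAt (fun t : ℝ => Real.cos (a * t) * c.2.2 - Real.sin (a * t) * x) (-(a * x))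
      0 := by
    have := hasDerivAt_rotation a c.2.2 (-x)
    simpa [sub_eq_add_neg] using this
  have hxt := hasDerivAt_rotation a x c.2.2
  have hht : HasDerivAt (fun t : ℝ => (k - α * (Real.cos (a * t) * c.2.2 - Real.sin (a * t) * x)) /
      (α + 1)) (α * (a * x) / (α + 1)) 0 := by
    have := ((hyt.const_mul α).const_sub k).div_const (α + 1)
    simpa using this
  have hrt : HasDerivAt (fun t : ℝ => radius ((k - α * (Real.cos (a * t) * c.2.2 -
      Real.sin (a * t) * x)) / (α + 1))) (-c.1.2 / ρ * (α * (a * x) / (α + 1))) 0 := by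
    have h1 : HasDerivAt radius (-c.1.2 / ρ) ((k - α * (Real.cos (a * 0) * c.2.2 -
      Real.sin (a * 0) * x)) / (α + 1)) := by
      simpa [hheight] using hasDerivAt_radius hh
    exact HasDerivAt.comp (0 : ℝ) (h₂ := radius) h1 hht
  have hζt := (hasDerivAt_exp_mul_I b).mul_const ζ
  have key := ((hrt.ofReal_comp.mul hζt).prodMk hht).prodMk
    ((hζt.mul (hxt.ofReal_comp.add_const ((z : ℂ) * Complex.I))).prodMk hyt)
  refine HasDerivAt.congr_deriv key ?_
  have hρ0 : (ρ : ℂ) ≠ 0 := by exact_mod_cast hr.ne'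
  have hα0 : (α : ℂ) ≠ 0 := by exact_mod_cast hα.ne'
  have hα1 : ((α : ℂ) + 1) ≠ 0 := by exact_mod_cast (by linarith : α + 1 ≠ 0)
  refine Prod.ext (Prod.ext ?_ ?_) (Prod.ext ?_ ?_)
  · simp only [mul_zero, Real.cos_zero, Real.sin_zero, one_mul, zero_mul, sub_zero, hheight,
      Complex.ofReal_zero, Complex.exp_zero, Prod.smul_mk, Complex.real_smul, ← hρ]
    rw [hw, hv, ha, hb]
    push_cast
    field_simp
    ring
  · simp only [Prod.smul_mk, smul_eq_mul]
    rw [ha]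
    field_simp
  · simp only [mul_zero, Real.cos_zero, Real.sin_zero, one_mul, zero_mul, add_zero,
      Complex.ofReal_zero, Complex.exp_zero, Prod.smul_mk, Complex.real_smul]
    rw [hw, hv, ha, hb]
    push_cast
    field_simp
  · simp only [Prod.smul_mk, smul_eq_mul]
    rw [ha]
    field_simp

/-- Reflection of the height of the second point in a level of `(-1, 1)`. -/
theorem exists_mem_Ham_annulus (hα : 0 < α) {k : ℝ} (hk : k ∈ Set.Ioo (-1 : ℝ) 1) :
    ∃ φ ∈ Ham (omega α), ∀ q, level α (coords q) = k →
      (coords (φ q)).2.2 = -(coords q).2.2 ∧ level α (coords (φ q)) = k := by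
  obtain ⟨f, hfs, -, hf, -, hfk⟩ := exists_contDiff_tsupport_subset (n := ⊤)
    (isOpen_Ioo.mem_nhds hk)
  -- The value `1/2` at level `k` makes the time-one rotation angle `2π κ(k)` equal to `π`.
  set κ : ℝ → ℝ := fun s => f s * (1 / 2) with hκdef
  have hκ : ContDiff ℝ ∞ κ := hf.mul contDiff_const
  have hκO : tsupport κ ⊆ Set.Ioo (-1 : ℝ) 1 := (tsupport_mul_subset_left).trans hfs
  obtain ⟨φ, hφ, hφ'⟩ := exists_mem_Ham_of_invariant hα isOpen_Ioo hκ hκO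
    (γ := fun h => (radius h)⁻¹) (δ := fun _ => α) (g := annulusFlow α κ)
    (fun c hc hk => (contDiffAt_radius (one_sub_height_sq_pos hα hc hk)).inv
      (radius_pos (one_sub_height_sq_pos hα hc hk)).ne')
    (fun c hc hk => contDiffAt_const)
    (fun t c hc hk => contDiffAt_annulusFlow hα hκ hc hk t)
    (fun t c hc hk => onSpheres_annulusChart
      (by rw [normSq_exp_mul_I_mul, normSq_phase hα hc hk]) (annulusFlow_radius_pos hα hc hk _)
      (by linarith [rotation_sq (2 * Real.pi * κ (level α c) * t) (rotated c).re c.2.2,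
        normSq_rotated hα hc hk]))
    (fun t c hc hk => level_annulusChart hα)
    (fun c hc hk => by simpa [annulusFlow] using annulusChart_self hα hc hk)
    (fun s t c hc hk => annulusFlow_add hα hc hk s t)
    (fun t c hc hk hs => by
      have h1 : κ (level α c) = 0 := image_eq_zero_of_notMem_tsupport hs
      have h2 : deriv κ (level α c) = 0 := by
        by_contra h
        exact hs (support_deriv_subset h)
      simpa [annulusFlow, h1, h2] using annulusChart_self hα hc hk)
    (fun c hc hk => hasDerivAt_annulusFlow hα hc hk)
  refine ⟨φ, hφ, fun q hq => ?_⟩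
  have hqO : level α (coords q) ∈ Set.Ioo (-1 : ℝ) 1 := hq ▸ hk
  rw [hφ' q hqO]
  refine ⟨?_, (level_annulusChart hα).trans hq⟩
  have h1 : 2 * Real.pi * κ (level α (coords q)) * 1 = Real.pi := by
    simp only [hκdef, hq, hfk]
    ring
  simp [annulusFlow, annulusChart, h1]

end Annulus

/-! ### Levels above `1`: unitary maps in the disc charts. -/

section Corner

/-- The ratio of the horizontal part of a point of height `h` and its coordinate in the
area-preserving disc chart of the sphere of area `2 * a` around the north pole. -/
def slope (a h : ℝ) : ℝ := Real.sqrt ((1 + h) / a)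

variable {a h : ℝ}

theorem slope_pos (ha : 0 < a) (hh : 0 < 1 + h) : 0 < slope a h := Real.sqrt_pos.2 (div_pos hh ha)

theorem mul_slope_sq (ha : 0 < a) (hh : 0 < 1 + h) : a * slope a h ^ 2 = 1 + h := by
  rw [slope, Real.sq_sqrt (div_pos hh ha).le]
  field_simp

theorem contDiffAt_slope (ha : 0 < a) (hh : 0 < 1 + h) : ContDiffAt ℝ ∞ (slope a) h :=
  (Real.contDiffAt_sqrt (div_pos hh ha).ne').comp h (f := fun h : ℝ => (1 + h) / a) (by fun_prop)

theorem hasDerivAt_slope (ha : 0 < a) (hh : 0 < 1 + h) :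
    HasDerivAt (slope a) (1 / (2 * a * slope a h)) h := by
  have h1 : HasDerivAt (fun h : ℝ => (1 + h) / a) (1 / a) h :=
    ((hasDerivAt_id h).const_add 1).div_const a
  refine (h1.sqrt (div_pos hh ha).ne').congr_deriv ?_
  change 1 / a / (2 * slope a h) = _
  field_simp

theorem hasDerivAt_inv_slope (ha : 0 < a) (hh : 0 < 1 + h) :
    HasDerivAt (fun h => (slope a h)⁻¹) (-1 / (2 * a * slope a h ^ 3)) h := by
  have hr := (slope_pos ha hh).ne'
  refine ((hasDerivAt_slope ha hh).inv hr).congr_deriv ?_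
  field_simp

/-- The coordinate of a point in the area-preserving disc chart around the north pole. -/
def disc (a : ℝ) (p : ℂ × ℝ) : ℂ := ((slope a p.2)⁻¹ : ℝ) * p.1

/-- The point with a given coordinate in the disc chart. -/
def discChart (a : ℝ) (W : ℂ) : ℂ × ℝ :=
  ((slope a (1 - Complex.normSq W / a) : ℝ) * W, 1 - Complex.normSq W / a)

theorem disc_discChart (ha : 0 < a) {W : ℂ} (hh : 0 < 1 + (discChart a W).2) :
    disc a (discChart a W) = W := by
  simp only [disc, discChart]
  have hs : (slope a (1 - Complex.normSq W / a))⁻¹ * slope a (1 - Complex.normSq W / a) = 1 :=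
    inv_mul_cancel₀ (slope_pos ha hh).ne'
  rw [← mul_assoc, ← Complex.ofReal_mul, hs, Complex.ofReal_one, one_mul]

theorem onSphere_discChart (ha : 0 < a) {W : ℂ} (hh : 0 < 1 + (discChart a W).2) :
    OnSphere (discChart a W) := by
  have h1 := mul_slope_sq ha hh
  have h2 : Complex.normSq W = a * (1 - (discChart a W).2) := by
    simp only [discChart]
    field_simp
    ring
  have h3 : (discChart a W).1 = (slope a (discChart a W).2 : ℝ) * W := rfl
  rw [OnSphere, h3, Complex.normSq_mul, Complex.normSq_ofReal, h2]
  linear_combination (1 - (discChart a W).2) * h1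

theorem normSq_disc (ha : 0 < a) {p : ℂ × ℝ} (hp : OnSphere p) (hh : 0 < 1 + p.2) :
    Complex.normSq (disc a p) = a * (1 - p.2) := by
  have h1 := mul_slope_sq ha hh
  have h2 : Complex.normSq p.1 = (1 - p.2) * (1 + p.2) := by
    unfold OnSphere at hp
    linarith
  have hs := (slope_pos ha hh).ne'
  rw [disc, Complex.normSq_mul, Complex.normSq_ofReal, h2, ← h1]
  field_simp

theorem discChart_disc (ha : 0 < a) {p : ℂ × ℝ} (hp : OnSphere p) (hh : 0 < 1 + p.2) :
    discChart a (disc a p) = p := by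
  have h1 : 1 - Complex.normSq (disc a p) / a = p.2 := by
    rw [normSq_disc ha hp hh]
    field_simp
    ring
  refine Prod.ext ?_ h1
  simp only [discChart]
  rw [h1, disc, ← mul_assoc, ← Complex.ofReal_mul, mul_inv_cancel₀ (slope_pos ha hh).ne',
    Complex.ofReal_one, one_mul]

theorem discChart_snd_le (ha : 0 < a) (W : ℂ) : (discChart a W).2 ≤ 1 := by
  have := div_nonneg (Complex.normSq_nonneg W) ha.le
  simp only [discChart]
  linarith

theorem OnSphere.height_le {c : ℂ × ℝ} (h : OnSphere c) : c.2 ≤ 1 :=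
  (abs_le.1 ((sq_le_one_iff_abs_le_one _).1 h.height_sq_le)).2

variable {α : ℝ} {κ : ℝ → ℝ} {c : (ℂ × ℝ) × (ℂ × ℝ)}

/-- If either height were at most `-1`, the level would be at most `1`. So both points avoid the
south pole and both disc charts apply. -/
theorem one_add_height_pos (hα : 0 < α) (h1 : c.1.2 ≤ 1) (h2 : c.2.2 ≤ 1)
    (hk : level α c ∈ Set.Ioi (1 : ℝ)) : 0 < 1 + c.1.2 ∧ 0 < 1 + c.2.2 := by
  simp only [level, Set.mem_Ioi] at hk
  constructor <;> nlinarith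

/-- The pair of points with given coordinates in the disc charts. -/
def cornerChart (α : ℝ) (W V : ℂ) : (ℂ × ℝ) × (ℂ × ℝ) := (discChart (α + 1) W, discChart α V)

/-- The level depends only on `|W|² + |V|²`, so every unitary map of `(W, V)` preserves it. -/
theorem level_cornerChart (hα : 0 < α) (W V : ℂ) :
    level α (cornerChart α W V) = 2 * α + 1 - Complex.normSq W - Complex.normSq V := by
  simp only [level, cornerChart, discChart]
  field_simp
  ring

theorem level_eq_disc (hα : 0 < α) (hc : OnSpheres c) (hk : level α c ∈ Set.Ioi (1 : ℝ)) :
    level α c = 2 * α + 1 - Complex.normSq (disc (α + 1) c.1) - Complex.normSq (disc α c.2) := by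
  obtain ⟨p1, p2⟩ := one_add_height_pos hα hc.1.height_le hc.2.height_le hk
  rw [normSq_disc (by linarith) hc.1 p1, normSq_disc hα hc.2 p2, level]
  ring

theorem cornerChart_self (hα : 0 < α) (hc : OnSpheres c) (hk : level α c ∈ Set.Ioi (1 : ℝ)) :
    cornerChart α (disc (α + 1) c.1) (disc α c.2) = c := by
  obtain ⟨p1, p2⟩ := one_add_height_pos hα hc.1.height_le hc.2.height_le hk
  exact Prod.ext (discChart_disc (by linarith) hc.1 p1) (discChart_disc hα hc.2 p2)

/-- The unitary rotation of `(W, V)` by the angle `τ`, followed by multiplication by `e ^ (i φ)`: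
first component. -/
def mixFst (φ τ : ℝ) (W V : ℂ) : ℂ :=
  Complex.exp (φ * Complex.I) * ((Real.cos τ : ℂ) * W - (Real.sin τ : ℂ) * V)

/-- The unitary rotation of `(W, V)` by the angle `τ`, followed by multiplication by `e ^ (i φ)`:
second component. -/
def mixSnd (φ τ : ℝ) (W V : ℂ) : ℂ :=
  Complex.exp (φ * Complex.I) * ((Real.cos τ : ℂ) * V + (Real.sin τ : ℂ) * W)

theorem normSq_mix (φ τ : ℝ) (W V : ℂ) : Complex.normSq (mixFst φ τ W V) +
    Complex.normSq (mixSnd φ τ W V) = Complex.normSq W + Complex.normSq V := by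
  rw [mixFst, mixSnd, normSq_exp_mul_I_mul, normSq_exp_mul_I_mul]
  simp only [Complex.normSq_apply, Complex.add_re, Complex.sub_re, Complex.mul_re, Complex.add_im,
    Complex.sub_im, Complex.mul_im, Complex.ofReal_re, Complex.ofReal_im]
  linear_combination (W.re ^ 2 + W.im ^ 2 + V.re ^ 2 + V.im ^ 2) * Real.cos_sq_add_sin_sq τ

/-- The common phase cancels, and the imaginary part is the determinant of the real and imaginary
parts, which a real rotation preserves. This conservation law keeps the phase speed of `cornerFlow`
constant along orbits. -/
theorem im_star_mul_mix (φ τ : ℝ) (W V : ℂ) :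
    (star (mixFst φ τ W V) * mixSnd φ τ W V).im = (star W * V).im := by
  have h : star (Complex.exp (φ * Complex.I)) * Complex.exp (φ * Complex.I) = 1 :=
    star_mul_self_eq_one (by rw [Complex.normSq_eq_norm_sq, Complex.norm_exp_ofReal_mul_I]; simp)
  rw [mixFst, mixSnd, star_mul', mul_mul_mul_comm, h, one_mul]
  simp only [Complex.star_def, map_sub, map_mul, Complex.conj_ofReal, Complex.mul_im,
    Complex.add_re, Complex.sub_re, Complex.mul_re, Complex.add_im, Complex.sub_im,
    Complex.ofReal_re, Complex.ofReal_im, Complex.conj_re, Complex.conj_im]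
  linear_combination (W.re * V.im - W.im * V.re) * Real.cos_sq_add_sin_sq τ

theorem mixFst_add (φ φ' τ τ' : ℝ) (W V : ℂ) : mixFst (φ + φ') (τ + τ') W V =
    mixFst φ τ (mixFst φ' τ' W V) (mixSnd φ' τ' W V) := by
  simp only [mixFst, mixSnd, Real.cos_add, Real.sin_add, Complex.ofReal_add, add_mul,
    Complex.exp_add]
  push_cast
  ring

theorem mixSnd_add (φ φ' τ τ' : ℝ) (W V : ℂ) : mixSnd (φ + φ') (τ + τ') W V =
    mixSnd φ τ (mixFst φ' τ' W V) (mixSnd φ' τ' W V) := by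
  simp only [mixFst, mixSnd, Real.cos_add, Real.sin_add, Complex.ofReal_add, add_mul,
    Complex.exp_add]
  push_cast
  ring

/-- The flow of an invariant Hamiltonian that acts by unitary maps in the disc charts on the
levels above `1`. -/
def cornerFlow (α : ℝ) (κ : ℝ → ℝ) (t : ℝ) (c : (ℂ × ℝ) × (ℂ × ℝ)) : (ℂ × ℝ) × (ℂ × ℝ) :=
  cornerChart α
    (mixFst (2 * Real.pi * deriv κ (level α c) * (star (disc (α + 1) c.1) * disc α c.2).im * t)
      (Real.pi * κ (level α c) * t) (disc (α + 1) c.1) (disc α c.2))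
    (mixSnd (2 * Real.pi * deriv κ (level α c) * (star (disc (α + 1) c.1) * disc α c.2).im * t)
      (Real.pi * κ (level α c) * t) (disc (α + 1) c.1) (disc α c.2))

theorem level_cornerFlow (hα : 0 < α) (hc : OnSpheres c) (hk : level α c ∈ Set.Ioi (1 : ℝ))
    (t : ℝ) : level α (cornerFlow α κ t c) = level α c := by
  rw [cornerFlow, level_cornerChart hα, sub_sub, normSq_mix, ← sub_sub, ← level_eq_disc hα hc hk]

theorem cornerFlow_height_pos (hα : 0 < α) (hc : OnSpheres c) (hk : level α c ∈ Set.Ioi (1 : ℝ))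
    (t : ℝ) : 0 < 1 + (cornerFlow α κ t c).1.2 ∧ 0 < 1 + (cornerFlow α κ t c).2.2 :=
  one_add_height_pos hα (discChart_snd_le (by linarith) _) (discChart_snd_le hα _)
    (by rwa [level_cornerFlow hα hc hk])

theorem onSpheres_cornerFlow (hα : 0 < α) (hc : OnSpheres c) (hk : level α c ∈ Set.Ioi (1 : ℝ))
    (t : ℝ) : OnSpheres (cornerFlow α κ t c) :=
  ⟨onSphere_discChart (by linarith) (cornerFlow_height_pos hα hc hk t).1,
    onSphere_discChart hα (cornerFlow_height_pos hα hc hk t).2⟩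

theorem cornerFlow_add (hα : 0 < α) (hc : OnSpheres c) (hk : level α c ∈ Set.Ioi (1 : ℝ))
    (s t : ℝ) : cornerFlow α κ (s + t) c = cornerFlow α κ s (cornerFlow α κ t c) := by
  have hlev := level_cornerFlow (κ := κ) hα hc hk t
  obtain ⟨p1, p2⟩ := cornerFlow_height_pos (κ := κ) hα hc hk t
  have h1 : disc (α + 1) (cornerFlow α κ t c).1 = _ := disc_discChart (by linarith) p1
  have h2 : disc α (cornerFlow α κ t c).2 = _ := disc_discChart hα p2
  conv_rhs => rw [cornerFlow, hlev, h1, h2, im_star_mul_mix]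
  rw [cornerFlow, mul_add, mul_add, mixFst_add, mixSnd_add]

theorem contDiffAt_discChart (ha : 0 < a) {W : ℂ} (hh : 0 < 1 + (discChart a W).2) :
    ContDiffAt ℝ ∞ (discChart a) W := by
  have h1 : ContDiffAt ℝ ∞ (fun W : ℂ => Complex.normSq W) W := by
    have e : (fun W : ℂ => Complex.normSq W) = fun W => W.re * W.re + W.im * W.im := by
      funext W
      exact Complex.normSq_apply W
    rw [e]
    have hid : ContDiffAt ℝ ∞ (fun W : ℂ => W) W := contDiffAt_id
    exact (hid.complex_re.mul hid.complex_re).add (hid.complex_im.mul hid.complex_im)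
  have h2 : ContDiffAt ℝ ∞ (fun W : ℂ => 1 - Complex.normSq W / a) W :=
    contDiffAt_const.sub (h1.div_const a)
  have h3 : ContDiffAt ℝ ∞ (fun W : ℂ => slope a (1 - Complex.normSq W / a)) W :=
    ContDiffAt.comp W (g := slope a) (contDiffAt_slope ha hh) h2
  exact (h3.complex_ofReal.mul contDiffAt_id).prodMk h2

theorem contDiffAt_disc (ha : 0 < a) {p : ℂ × ℝ} (hh : 0 < 1 + p.2) :
    ContDiffAt ℝ ∞ (disc a) p := by
  have h3 : ContDiffAt ℝ ∞ (fun p : ℂ × ℝ => slope a p.2) p :=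
    ContDiffAt.comp p (g := slope a) (contDiffAt_slope ha hh) contDiffAt_snd
  exact (ContDiffAt.complex_ofReal (h3.inv (slope_pos ha hh).ne')).mul contDiffAt_fst

theorem contDiffAt_cornerFlow (hα : 0 < α) (hκ : ContDiff ℝ ∞ κ) (hc : OnSpheres c)
    (hk : level α c ∈ Set.Ioi (1 : ℝ)) (t : ℝ) :
    ContDiffAt ℝ ∞ (fun z : ℝ × (ℂ × ℝ) × (ℂ × ℝ) => cornerFlow α κ z.1 z.2) (t, c) := by
  obtain ⟨p1, p2⟩ := one_add_height_pos hα hc.1.height_le hc.2.height_le hk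
  obtain ⟨q1, q2⟩ := cornerFlow_height_pos (κ := κ) hα hc hk t
  have ht : ContDiffAt ℝ ∞ (fun z : ℝ × (ℂ × ℝ) × (ℂ × ℝ) => z.1) (t, c) := contDiffAt_fst
  have hl : ContDiffAt ℝ ∞ (fun z : ℝ × (ℂ × ℝ) × (ℂ × ℝ) => level α z.2) (t, c) :=
    ((contDiff_level α).comp contDiff_snd).contDiffAt
  have hW : ContDiffAt ℝ ∞ (fun z : ℝ × (ℂ × ℝ) × (ℂ × ℝ) => disc (α + 1) z.2.1) (t, c) :=
    ContDiffAt.comp (t, c) (g := disc (α + 1)) (f := fun z : ℝ × (ℂ × ℝ) × (ℂ × ℝ) => z.2.1)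
      (contDiffAt_disc (by linarith) p1) (by fun_prop)
  have hV : ContDiffAt ℝ ∞ (fun z : ℝ × (ℂ × ℝ) × (ℂ × ℝ) => disc α z.2.2) (t, c) :=
    ContDiffAt.comp (t, c) (g := disc α) (f := fun z : ℝ × (ℂ × ℝ) × (ℂ × ℝ) => z.2.2)
      (contDiffAt_disc hα p2) (by fun_prop)
  have hκl := hκ.contDiffAt.comp (t, c) hl
  have hκ'l := (contDiff_infty_iff_deriv.1 hκ).2.contDiffAt.comp (t, c) hl
  have hτ : ContDiffAt ℝ ∞ (fun z : ℝ × (ℂ × ℝ) × (ℂ × ℝ) =>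
      Real.pi * κ (level α z.2) * z.1) (t, c) := (contDiffAt_const.mul hκl).mul ht
  have hcos := Real.contDiff_cos.contDiffAt.comp (t, c) hτ
  have hsin := Real.contDiff_sin.contDiffAt.comp (t, c) hτ
  have hexp : ContDiffAt ℝ ∞ (fun z : ℝ × (ℂ × ℝ) × (ℂ × ℝ) =>
      Complex.exp ((2 * Real.pi * deriv κ (level α z.2) *
        (star (disc (α + 1) z.2.1) * disc α z.2.2).im * z.1 : ℝ) * Complex.I)) (t, c) :=
    (ContDiffAt.mul (ContDiffAt.complex_ofReal (((contDiffAt_const.mul hκ'l).mul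
      (hW.complex_star.mul hV).complex_im).mul ht)) contDiffAt_const).cexp
  have hWt : ContDiffAt ℝ ∞ (fun z : ℝ × (ℂ × ℝ) × (ℂ × ℝ) =>
      mixFst (2 * Real.pi * deriv κ (level α z.2) *
          (star (disc (α + 1) z.2.1) * disc α z.2.2).im * z.1)
        (Real.pi * κ (level α z.2) * z.1) (disc (α + 1) z.2.1) (disc α z.2.2)) (t, c) :=
    hexp.mul ((hcos.complex_ofReal.mul hW).sub (hsin.complex_ofReal.mul hV))
  have hVt : ContDiffAt ℝ ∞ (fun z : ℝ × (ℂ × ℝ) × (ℂ × ℝ) =>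
      mixSnd (2 * Real.pi * deriv κ (level α z.2) *
          (star (disc (α + 1) z.2.1) * disc α z.2.2).im * z.1)
        (Real.pi * κ (level α z.2) * z.1) (disc (α + 1) z.2.1) (disc α z.2.2)) (t, c) :=
    hexp.mul ((hcos.complex_ofReal.mul hV).add (hsin.complex_ofReal.mul hW))
  have hD1 := contDiffAt_discChart (a := α + 1) (by linarith) q1
  have hD2 := contDiffAt_discChart hα q2
  exact (hD1.comp (t, c) hWt).prodMk (hD2.comp (t, c) hVt)

/-- The derivative of a curve given in the disc chart. -/
theorem hasDerivAt_discChart (ha : 0 < a) {f : ℝ → ℂ} {f' : ℂ} {t : ℝ} (hf : HasDerivAt f f' t)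
    (hh : 0 < 1 + (discChart a (f t)).2) :
    HasDerivAt (fun s => discChart a (f s))
      (((1 / (2 * a * slope a (discChart a (f t)).2) * (-(2 * (star (f t) * f').re / a)) : ℝ) : ℂ) *
          f t + (slope a (discChart a (f t)).2 : ℝ) * f', -(2 * (star (f t) * f').re / a)) t := by
  have h1 : HasDerivAt (fun s => (f s).re) f'.re t :=
    Complex.reCLM.hasFDerivAt.comp_hasDerivAt t hf
  have h2 : HasDerivAt (fun s => (f s).im) f'.im t :=
    Complex.imCLM.hasFDerivAt.comp_hasDerivAt t hf
  have h3 : HasDerivAt (fun s => 1 - Complex.normSq (f s) / a) (-(2 * (star (f t) * f').re / a))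
      t := by
    simp only [Complex.normSq_apply]
    refine ((((h1.mul h1).add (h2.mul h2)).div_const a).const_sub 1).congr_deriv ?_
    simp
    ring
  have h4 := HasDerivAt.comp t (h₂ := slope a) (hasDerivAt_slope ha hh) h3
  exact (h4.ofReal_comp.mul hf).prodMk h3

theorem hasDerivAt_mixFst (b e : ℝ) (W V : ℂ) :
    HasDerivAt (fun t : ℝ => mixFst (b * t) (e * t) W V) (b * Complex.I * W - e * V) 0 := by
  have h1 : HasDerivAt (fun t : ℝ => e * t) e 0 := by
    simpa using (hasDerivAt_id (0 : ℝ)).const_mul e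
  refine ((hasDerivAt_exp_mul_I b).mul ((h1.cos.ofReal_comp.mul_const W).sub
    (h1.sin.ofReal_comp.mul_const V))).congr_deriv ?_
  simp
  ring

theorem hasDerivAt_mixSnd (b e : ℝ) (W V : ℂ) :
    HasDerivAt (fun t : ℝ => mixSnd (b * t) (e * t) W V) (b * Complex.I * V + e * W) 0 := by
  have h1 : HasDerivAt (fun t : ℝ => e * t) e 0 := by
    simpa using (hasDerivAt_id (0 : ℝ)).const_mul e
  refine ((hasDerivAt_exp_mul_I b).mul ((h1.cos.ofReal_comp.mul_const V).add
    (h1.sin.ofReal_comp.mul_const W))).congr_deriv ?_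
  simp

/-- This and its companion `re_sub_im_mul_eq` remove the real and imaginary parts of `star W * V`
from the velocity of the flow. -/
theorem re_add_im_mul_eq (W V : ℂ) :
    (((star W * V).re : ℂ) + ((star W * V).im : ℂ) * Complex.I) * W =
      (Complex.normSq W : ℂ) * V := by
  rw [Complex.re_add_im, Complex.star_def, Complex.normSq_eq_conj_mul_self]
  ring

theorem re_sub_im_mul_eq (W V : ℂ) :
    (((star W * V).re : ℂ) - ((star W * V).im : ℂ) * Complex.I) * V =
      (Complex.normSq V : ℂ) * W := by
  have h : ((star W * V).re : ℂ) - ((star W * V).im : ℂ) * Complex.I = star (star W * V) := by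
    apply Complex.ext
    · simp
    · simp
      ring
  rw [h, star_mul', star_star, Complex.star_def, Complex.normSq_eq_conj_mul_self]
  ring

/-- With `γ` and `δ` the inverse slopes, the Hamiltonian is `κ(K) Im (star W * V)`. It generates the
real rotation of `(W, V)` at speed `π κ(K)`, plus a common phase of speed `2π κ'(K) Im (star W * V)`
from the cutoff. -/
theorem hasDerivAt_cornerFlow (hα : 0 < α) (hc : OnSpheres c)
    (hk : level α c ∈ Set.Ioi (1 : ℝ)) :
    HasDerivAt (fun s => cornerFlow α κ s c)
      ((2 * Real.pi / (α + 1)) • fieldFst α (κ (level α c)) (deriv κ (level α c))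
          (slope (α + 1) c.1.2)⁻¹ (deriv (fun h => (slope (α + 1) h)⁻¹) c.1.2)
          (slope α c.2.2)⁻¹ c,
        (2 * Real.pi / α) • fieldSnd α (κ (level α c)) (deriv κ (level α c))
          (slope (α + 1) c.1.2)⁻¹ (slope α c.2.2)⁻¹
          (deriv (fun h => (slope α h)⁻¹) c.2.2) c) 0 := by
  have hα1 : 0 < α + 1 := by linarith
  obtain ⟨p1, p2⟩ := one_add_height_pos hα hc.1.height_le hc.2.height_le hk
  have s1 := slope_pos hα1 p1
  have s2 := slope_pos hα p2
  have hself := cornerChart_self hα hc hk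
  have hself1 : discChart (α + 1) (disc (α + 1) c.1) = c.1 := congrArg Prod.fst hself
  have hself2 : discChart α (disc α c.2) = c.2 := congrArg Prod.snd hself
  have hw : c.1.1 = (slope (α + 1) c.1.2 : ℝ) * disc (α + 1) c.1 := by
    rw [disc, ← mul_assoc, ← Complex.ofReal_mul, mul_inv_cancel₀ s1.ne', Complex.ofReal_one,
      one_mul]
  have hv : c.2.1 = (slope α c.2.2 : ℝ) * disc α c.2 := by
    rw [disc, ← mul_assoc, ← Complex.ofReal_mul, mul_inv_cancel₀ s2.ne', Complex.ofReal_one,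
      one_mul]
  have hwv : star c.1.1 * c.2.1 = ((slope (α + 1) c.1.2 * slope α c.2.2 : ℝ) : ℂ) *
      (star (disc (α + 1) c.1) * disc α c.2) := by
    conv_lhs => rw [hw, hv]
    rw [star_mul', Complex.star_def, Complex.conj_ofReal]
    push_cast
    ring
  have hre : (star c.1.1 * c.2.1).re = slope (α + 1) c.1.2 * slope α c.2.2 *
      (star (disc (α + 1) c.1) * disc α c.2).re := by
    rw [hwv, Complex.re_ofReal_mul]
  have him : (star c.1.1 * c.2.1).im = slope (α + 1) c.1.2 * slope α c.2.2 *
      (star (disc (α + 1) c.1) * disc α c.2).im := by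
    rw [hwv, Complex.im_ofReal_mul]
  rw [(hasDerivAt_inv_slope hα1 p1).deriv, (hasDerivAt_inv_slope hα p2).deriv]
  simp only [fieldFst, fieldSnd, hre, him]
  have n1 := re_add_im_mul_eq (disc (α + 1) c.1) (disc α c.2)
  have n2 := re_sub_im_mul_eq (disc (α + 1) c.1) (disc α c.2)
  rw [normSq_disc hα1 hc.1 p1] at n1
  rw [normSq_disc hα hc.2 p2] at n2
  have q1 := mul_slope_sq hα1 p1
  have q2 := mul_slope_sq hα p2
  have hflow : (fun s => cornerFlow α κ s c) = fun s : ℝ => cornerChart α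
      (mixFst (2 * Real.pi * deriv κ (level α c) * (star (disc (α + 1) c.1) * disc α c.2).im * s)
        (Real.pi * κ (level α c) * s) (disc (α + 1) c.1) (disc α c.2))
      (mixSnd (2 * Real.pi * deriv κ (level α c) * (star (disc (α + 1) c.1) * disc α c.2).im * s)
        (Real.pi * κ (level α c) * s) (disc (α + 1) c.1) (disc α c.2)) := rfl
  rw [hflow]
  set k := level α c with hkdef
  set S1 := slope (α + 1) c.1.2 with hS1
  set S2 := slope α c.2.2 with hS2
  set W := disc (α + 1) c.1
  set V := disc α c.2
  set R := (star W * V).re with hR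
  set J := (star W * V).im with hJ
  set b := 2 * Real.pi * deriv κ k * J with hb
  set e := Real.pi * κ k with he
  have m1 : mixFst (b * 0) (e * 0) W V = W := by simp [mixFst]
  have m2 : mixSnd (b * 0) (e * 0) W V = V := by simp [mixSnd]
  have d1 := hasDerivAt_discChart hα1 (hasDerivAt_mixFst b e W V)
    (by rw [m1, hself1]; exact p1)
  have d2 := hasDerivAt_discChart hα (hasDerivAt_mixSnd b e W V)
    (by rw [m2, hself2]; exact p2)
  rw [m1, hself1, ← hS1] at d1
  rw [m2, hself2, ← hS2] at d2
  have r1 : (star W * (b * Complex.I * W - e * V)).re = -(e * R) := by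
    rw [hR]
    simp
    ring
  have r2 : (star V * (b * Complex.I * V + e * W)).re = e * R := by
    rw [hR]
    simp
    ring
  rw [r1] at d1
  rw [r2] at d2
  refine (d1.prodMk d2).congr_deriv ?_
  have S1c : (S1 : ℂ) ≠ 0 := by exact_mod_cast s1.ne'
  have S2c : (S2 : ℂ) ≠ 0 := by exact_mod_cast s2.ne'
  have αc : (α : ℂ) ≠ 0 := by exact_mod_cast hα.ne'
  have αc1 : (α : ℂ) + 1 ≠ 0 := by exact_mod_cast hα1.ne'
  have q1c : ((α : ℂ) + 1) * (S1 : ℂ) ^ 2 = 1 + (c.1.2 : ℂ) := by exact_mod_cast q1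
  have q2c : (α : ℂ) * (S2 : ℂ) ^ 2 = 1 + (c.2.2 : ℂ) := by exact_mod_cast q2
  push_cast at n1 n2
  refine Prod.ext (Prod.ext ?_ ?_) (Prod.ext ?_ ?_)
  · simp only [Prod.smul_mk, Complex.real_smul]
    rw [hw, hv, he, hb]
    push_cast
    field_simp
    linear_combination (κ k : ℂ) * (n1 - ((α : ℂ) + 1) * V * q1c)
  · simp only [Prod.smul_mk, smul_eq_mul]
    rw [he]
    field_simp
  · simp only [Prod.smul_mk, Complex.real_smul]
    rw [hw, hv, he, hb]
    push_cast
    field_simp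
    linear_combination (κ k : ℂ) * (-n2 + (α : ℂ) * W * q2c)
  · simp only [Prod.smul_mk, smul_eq_mul]
    rw [he]
    field_simp

/-- Exchange of the two disc coordinates on a level above `1`. -/
theorem exists_mem_Ham_corner (hα : 0 < α) {k : ℝ} (hk : k ∈ Set.Ioi (1 : ℝ)) :
    ∃ φ ∈ Ham (omega α), ∀ q, level α (coords q) = k →
      α * (1 - (coords (φ q)).2.2) = (α + 1) * (1 - (coords q).1.2) ∧
        level α (coords (φ q)) = k := by
  obtain ⟨f, hfs, -, hf, -, hfk⟩ := exists_contDiff_tsupport_subset (n := ⊤)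
    (isOpen_Ioi.mem_nhds hk)
  -- Now `κ(k) = 1/2` gives the angle `π κ(k) = π / 2`, which exchanges `|W|` and `|V|`.
  set κ : ℝ → ℝ := fun s => f s * (1 / 2) with hκdef
  have hκ : ContDiff ℝ ∞ κ := hf.mul contDiff_const
  have hκO : tsupport κ ⊆ Set.Ioi (1 : ℝ) := (tsupport_mul_subset_left).trans hfs
  have hα1 : 0 < α + 1 := by linarith
  have hpos := fun (c : (ℂ × ℝ) × (ℂ × ℝ)) (hc : OnSpheres c) (hk : level α c ∈ Set.Ioi (1 : ℝ)) =>
    one_add_height_pos hα hc.1.height_le hc.2.height_le hk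
  obtain ⟨φ, hφ, hφ'⟩ := exists_mem_Ham_of_invariant hα isOpen_Ioi hκ hκO
    (γ := fun h => (slope (α + 1) h)⁻¹) (δ := fun h => (slope α h)⁻¹) (g := cornerFlow α κ)
    (fun c hc hk => (contDiffAt_slope hα1 (hpos c hc hk).1).inv (slope_pos hα1 (hpos c hc hk).1).ne')
    (fun c hc hk => (contDiffAt_slope hα (hpos c hc hk).2).inv (slope_pos hα (hpos c hc hk).2).ne')
    (fun t c hc hk => contDiffAt_cornerFlow hα hκ hc hk t)
    (fun t c hc hk => onSpheres_cornerFlow hα hc hk t)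
    (fun t c hc hk => level_cornerFlow hα hc hk t)
    (fun c hc hk => by simpa [cornerFlow, mixFst, mixSnd] using cornerChart_self hα hc hk)
    (fun s t c hc hk => cornerFlow_add hα hc hk s t)
    (fun t c hc hk hs => by
      have h1 : κ (level α c) = 0 := image_eq_zero_of_notMem_tsupport hs
      have h2 : deriv κ (level α c) = 0 := by
        by_contra h
        exact hs (support_deriv_subset h)
      simpa [cornerFlow, mixFst, mixSnd, h1, h2] using cornerChart_self hα hc hk)
    (fun c hc hk => hasDerivAt_cornerFlow hα hc hk)
  refine ⟨φ, hφ, fun q hq => ?_⟩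
  have hqO : level α (coords q) ∈ Set.Ioi (1 : ℝ) := hq ▸ hk
  have hc := onSpheres_coords q
  rw [hφ' q hqO, level_cornerFlow hα hc hqO]
  refine ⟨?_, hq⟩
  have h1 : Real.pi * κ (level α (coords q)) * 1 = Real.pi / 2 := by
    simp only [hκdef, hq, hfk]
    ring
  rw [← normSq_disc hα1 hc.1 (hpos _ hc hqO).1]
  simp only [cornerFlow, cornerChart, discChart, h1, mixSnd, normSq_exp_mul_I_mul]
  simp
  field_simp

end Corner

/-! ### Rotations of the two factors about horizontal axes. -/

section Rotations

/-- The rotation of the sphere about the first coordinate axis. -/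
def axisRotation (θ : ℝ) (p : ℂ × ℝ) : ℂ × ℝ :=
  ((p.1.re : ℂ) + ((Real.cos θ * p.1.im - Real.sin θ * p.2 : ℝ) : ℂ) * Complex.I,
    Real.sin θ * p.1.im + Real.cos θ * p.2)

theorem onSphere_axisRotation (θ : ℝ) {p : ℂ × ℝ} (hp : OnSphere p) :
    OnSphere (axisRotation θ p) := by
  unfold OnSphere at hp ⊢
  rw [Complex.normSq_apply] at hp
  simp only [axisRotation, Complex.normSq_add_mul_I]
  linear_combination (p.1.im ^ 2 + p.2 ^ 2) * Real.cos_sq_add_sin_sq θ + hp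

theorem axisRotation_zero (p : ℂ × ℝ) : axisRotation 0 p = p := by
  simp [axisRotation]

theorem axisRotation_add (θ θ' : ℝ) (p : ℂ × ℝ) :
    axisRotation (θ + θ') p = axisRotation θ (axisRotation θ' p) := by
  simp only [axisRotation, Real.cos_add, Real.sin_add]
  refine Prod.ext ?_ ?_
  · simp only [Complex.add_re, Complex.add_im, Complex.mul_re, Complex.mul_im, Complex.ofReal_re,
      Complex.ofReal_im, Complex.I_re, Complex.I_im]
    push_cast
    ring
  · simp only [Complex.add_im, Complex.mul_im, Complex.ofReal_re, Complex.ofReal_im, Complex.I_re,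
      Complex.I_im]
    ring

theorem contDiff_axisRotation : ContDiff ℝ ∞ (fun z : ℝ × ℂ × ℝ => axisRotation z.1 z.2) := by
  rw [contDiff_iff_contDiffAt]
  intro z
  have hθ : ContDiffAt ℝ ∞ (fun z : ℝ × ℂ × ℝ => z.1) z := contDiffAt_fst
  have hw : ContDiffAt ℝ ∞ (fun z : ℝ × ℂ × ℝ => z.2.1) z := by fun_prop
  have hh : ContDiffAt ℝ ∞ (fun z : ℝ × ℂ × ℝ => z.2.2) z := by fun_prop
  have hcos := Real.contDiff_cos.contDiffAt.comp z hθ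
  have hsin := Real.contDiff_sin.contDiffAt.comp z hθ
  exact (hw.complex_re.complex_ofReal.add (((hcos.mul hw.complex_im).sub
    (hsin.mul hh)).complex_ofReal.mul contDiffAt_const)).prodMk
      ((hsin.mul hw.complex_im).add (hcos.mul hh))

theorem hasDerivAt_toE3_axisRotation (a : ℝ) (p : ℂ × ℝ) :
    HasDerivAt (fun t : ℝ => toE3 (axisRotation (a * t) p))
      (toE3 (((-(a * p.2) : ℝ) : ℂ) * Complex.I, a * p.1.im)) 0 := by
  have h1 : HasDerivAt (fun t : ℝ => Real.cos (a * t) * p.1.im - Real.sin (a * t) * p.2)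
      (-(a * p.2)) 0 := by
    have := hasDerivAt_rotation a p.1.im (-p.2)
    simpa [sub_eq_add_neg] using this
  have h2 : HasDerivAt (fun t : ℝ => Real.sin (a * t) * p.1.im + Real.cos (a * t) * p.2)
      (a * p.1.im) 0 := by
    have := hasDerivAt_rotation a p.2 p.1.im
    simpa [add_comm] using this
  exact hasDerivAt_toE3 ((h1.ofReal_comp.mul_const Complex.I).const_add _) h2

/-- A linear function on each sphere generates the rotations about its axis. The angle `π` reverses
the height. -/
theorem exists_mem_Ham_rotation {α : ℝ} (a b : ℝ) :
    ∃ φ ∈ Ham (omega α), ∀ q,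
      coords (φ q) = (axisRotation a (coords q).1, axisRotation b (coords q).2) := by
  set Ft : E3 × E3 → ℝ := fun z =>
    (α + 1) / (2 * Real.pi) * (a * z.1 0) + α / (2 * Real.pi) * (b * z.2 0) with hFt
  have hFts : ContDiff ℝ ∞ Ft := by
    have h1 : ContDiff ℝ ∞ (fun z : E3 × E3 => z.1 0) := by fun_prop
    have h2 : ContDiff ℝ ∞ (fun z : E3 × E3 => z.2 0) := by fun_prop
    exact (contDiff_const.mul (contDiff_const.mul h1)).add
      (contDiff_const.mul (contDiff_const.mul h2))
  -- No cutoff is needed: with a constant `K` and `O = C = univ` the conditions outside `C` are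
  -- vacuous.
  obtain ⟨φ, hφ, h⟩ := exists_mem_Ham_of_local (α := α) (K := fun _ => 0) continuous_const
    isOpen_univ isClosed_univ subset_rfl (F := fun q => Ft (q.1, q.2))
    (g := fun t c => (axisRotation (a * t) c.1, axisRotation (b * t) c.2))
    (fun t c _ _ => by
      refine ContDiffAt.prodMk ?_ ?_
      · exact contDiff_axisRotation.contDiffAt.comp (t, c)
          (f := fun z : ℝ × (ℂ × ℝ) × (ℂ × ℝ) => (a * z.1, z.2.1)) (by fun_prop)
      · exact contDiff_axisRotation.contDiffAt.comp (t, c)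
          (f := fun z : ℝ × (ℂ × ℝ) × (ℂ × ℝ) => (b * z.1, z.2.2)) (by fun_prop))
    (fun t c hc _ => ⟨onSphere_axisRotation _ hc.1, onSphere_axisRotation _ hc.2⟩)
    (fun _ _ _ _ => rfl)
    (fun c _ _ => by simp [axisRotation_zero])
    (fun s t c _ _ => by simp [mul_add, axisRotation_add])
    (fun t c _ _ hn => absurd (Set.mem_univ _) hn)
    (fun q _ => hFts.contDiffAt.comp_contMDiffAt
      (f := fun q : S2 × S2 => ((q.1 : E3), (q.2 : E3)))
      ((contMDiff_val_fst.prodMk_space contMDiff_val_snd) q))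
    (fun q hn => absurd (Set.mem_univ _) hn)
    (fun c hc _ hcs => by
      have hval1 : (fun s => ((c s).1 : E3)) = fun s => toE3 (axisRotation (a * s) (coord (c 0).1)) := by
        funext s
        rw [← toE3_coord]
        exact congrArg (fun z => toE3 z.1) (hcs s)
      have hval2 : (fun s => ((c s).2 : E3)) = fun s => toE3 (axisRotation (b * s) (coord (c 0).2)) := by
        funext s
        rw [← toE3_coord]
        exact congrArg (fun z => toE3 z.2) (hcs s)
      refine satisfiesHamilton_of_hasDerivAt (Ft := Ft) (hc 0)
        (by rw [hval1]; exact hasDerivAt_toE3_axisRotation a _)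
        (by rw [hval2]; exact hasDerivAt_toE3_axisRotation b _)
        Filter.EventuallyEq.rfl (hFts.differentiable (by simp) _) fun v w hv hw => ?_
      have e : ∀ (r : ℝ) (x y : E3), HasDerivAt (fun s : ℝ => r * (x + s • y) 0) (r * y 0) 0 := by
        intro r x y
        simpa using (((hasDerivAt_id (0 : ℝ)).mul_const (y 0)).const_add (x 0)).const_mul r
      refine (((e a _ v).const_mul _).add ((e b _ w).const_mul _)).congr_deriv ?_
      have hu := S2.sum_sq (c 0).1
      have hp := S2.sum_sq (c 0).2
      rw [inner_E3] at hv hw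
      rw [tripleProduct_apply, tripleProduct_apply]
      simp only [coord, toE3_zero, toE3_one, toE3_two, Complex.mul_re, Complex.mul_im,
        Complex.ofReal_re, Complex.ofReal_im, Complex.I_re, Complex.I_im]
      congr 1
      · congr 1
        linear_combination (-(a * v 0)) * hu + a * ((c 0).1 : E3) 0 * hv
      · congr 1
        linear_combination (-(b * w 0)) * hp + b * ((c 0).2 : E3) 0 * hw)
  refine ⟨φ, hφ, fun q => ?_⟩
  simpa using h q (Set.mem_univ _)

end Rotations

/-! ### The resulting moves between split tori. -/

section Tori

variable {α : ℝ}

theorem mem_splitTorus_iff (hα : 0 < α) {x y : ℝ} {q : S2 × S2} : q ∈ splitTorus α x y ↔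
    (α + 1) * (coords q).1.2 = x ∧ α * (coords q).2.2 = y := by
  have hα1 : α + 1 ≠ 0 := by linarith
  have e1 : (coords q).1.2 = 2 * x / (2 * (α + 1)) ↔ (α + 1) * (coords q).1.2 = x := by
    rw [mul_div_mul_left _ _ two_ne_zero, eq_div_iff hα1, mul_comm]
  have e2 : (coords q).2.2 = 2 * y / (2 * α) ↔ α * (coords q).2.2 = y := by
    rw [mul_div_mul_left _ _ two_ne_zero, eq_div_iff hα.ne', mul_comm]
  exact and_congr e1 e2

/-- Some Hamiltonian diffeomorphism maps the split torus over `z` into the split torus over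
`z'`. -/
def Reachable (α : ℝ) (z z' : ℝ × ℝ) : Prop :=
  ∃ φ ∈ Ham (omega α), ∀ q ∈ splitTorus α z.1 z.2, φ q ∈ splitTorus α z'.1 z'.2

theorem Reachable.refl (z : ℝ × ℝ) : Reachable α z z :=
  ⟨_, refl_mem_Ham _, fun _ hq => hq⟩

theorem Reachable.trans {z z' z'' : ℝ × ℝ} (h : Reachable α z z') (h' : Reachable α z' z'') :
    Reachable α z z'' := by
  obtain ⟨φ, hφ, h⟩ := h
  obtain ⟨ψ, hψ, h'⟩ := h'
  exact ⟨_, trans_mem_Ham hφ hψ, fun q hq => h' _ (h _ hq)⟩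

theorem reachable_neg_fst (hα : 0 < α) (x y : ℝ) : Reachable α (x, y) (-x, y) := by
  obtain ⟨φ, hφ, h⟩ := exists_mem_Ham_rotation (α := α) Real.pi 0
  refine ⟨φ, hφ, fun q hq => ?_⟩
  rw [mem_splitTorus_iff hα] at hq ⊢
  rw [h]
  simpa [axisRotation] using hq

theorem reachable_neg_snd (hα : 0 < α) (x y : ℝ) : Reachable α (x, y) (x, -y) := by
  obtain ⟨φ, hφ, h⟩ := exists_mem_Ham_rotation (α := α) 0 Real.pi
  refine ⟨φ, hφ, fun q hq => ?_⟩
  rw [mem_splitTorus_iff hα] at hq ⊢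
  rw [h]
  simpa [axisRotation] using hq

/-- The half turn reverses `y` and keeps the level `x + y`, giving `(x + 2y, -y)`; a reflection
restores the sign of `y`. -/
theorem reachable_annulus (hα : 0 < α) {x y : ℝ} (h : |x + y| < 1) :
    Reachable α (x, y) (x + 2 * y, y) := by
  refine Reachable.trans (z' := (x + 2 * y, -y)) ?_ (by simpa using reachable_neg_snd hα _ (-y))
  obtain ⟨φ, hφ, h⟩ := exists_mem_Ham_annulus hα (k := x + y) (abs_lt.1 h)
  refine ⟨φ, hφ, fun q hq => ?_⟩
  rw [mem_splitTorus_iff hα] at hq ⊢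
  obtain ⟨h1, h2⟩ := h q (by rw [level, hq.1, hq.2])
  unfold level at h2
  rw [h1] at h2 ⊢
  constructor <;> dsimp only at hq ⊢ <;> linarith

/-- On the torus `|W|² = α + 1 - x` and `|V|² = α - y`; the quarter turn exchanges these two
numbers. -/
theorem reachable_corner (hα : 0 < α) {x y : ℝ} (h : 1 < x + y) :
    Reachable α (x, y) (1 + y, x - 1) := by
  obtain ⟨φ, hφ, h⟩ := exists_mem_Ham_corner hα (k := x + y) h
  refine ⟨φ, hφ, fun q hq => ?_⟩
  rw [mem_splitTorus_iff hα] at hq ⊢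
  obtain ⟨h1, h2⟩ := h q (by rw [level, hq.1, hq.2])
  unfold level at h2
  constructor <;> dsimp only at hq ⊢ <;> linarith

/-- A bounce off the right side: upper side to right side, reflection there, back to the upper side
at `2 - x`, and a final reflection. The two corner moves use levels `x + r` and `2 + r - x`, which
exceed `1` exactly under the two hypotheses. -/
theorem reachable_sub_two (hα : 0 < α) {x r : ℝ} (h1 : 1 - r < x) (h2 : x < 1 + r) :
    Reachable α (x, r) (x - 2, r) := by
  have e1 : Reachable α (x, r) (1 + r, x - 1) := reachable_corner hα (by linarith)
  have e2 : Reachable α (1 + r, x - 1) (1 + r, 1 - x) := by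
    simpa using reachable_neg_snd hα (1 + r) (x - 1)
  have e3 : Reachable α (1 + r, 1 - x) (1 + (1 - x), 1 + r - 1) :=
    reachable_corner hα (by linarith)
  have e4 := reachable_neg_fst hα (1 + (1 - x)) (1 + r - 1)
  have e5 : (-(1 + (1 - x)), 1 + r - 1) = (x - 2, r) := Prod.ext (by ring) (by ring)
  rw [e5] at e4
  exact ((e1.trans e2).trans e3).trans e4

end Tori

/-! ### Billiard orbits and the packing number. -/

section Billiard

/-- The first return map of the billiard of slope `1` in the rectangle of half side lengths
`1 + r` and `r` to the upper side, up to reflections. -/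
def billiard (r x : ℝ) : ℝ := if x < 1 - r then x + 2 * r else x - 2

/-- Since `x - 2 = x + 2 r - (2 + 2 r)`, both branches are translation by `2 r` modulo `2 + 2 r`. -/
theorem billiard_iterate_eq (r s : ℝ) (n : ℕ) :
    ∃ k : ℤ, (billiard r)^[n] s = s + 2 * r * n - (2 + 2 * r) * k := by
  induction n with
  | zero => exact ⟨0, by simp⟩
  | succ n ih =>
    obtain ⟨k, hk⟩ := ih
    rw [Function.iterate_succ_apply', billiard]
    split_ifs
    · exact ⟨k, by rw [hk]; push_cast; ring⟩
    · exact ⟨k + 1, by rw [hk]; push_cast; ring⟩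

theorem int_eq_zero_of_irrational_mul_eq {r : ℝ} (hr : Irrational r) {a b : ℤ} (h : r * a = b) :
    a = 0 ∧ b = 0 := by
  have ha : a = 0 := by
    by_contra ha
    refine hr ⟨(b : ℚ) / a, ?_⟩
    have ha' : (a : ℝ) ≠ 0 := by exact_mod_cast ha
    push_cast
    rw [← h]
    field_simp
  subst ha
  refine ⟨rfl, ?_⟩
  have : (b : ℝ) = 0 := by simpa using h.symm
  exact_mod_cast this

/-- A repetition gives `r (m - n - (k - l)) = k - l` with integers `k`, `l`; irrationality forces `k
= l`, then `m = n`. -/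
theorem billiard_iterate_injective {r : ℝ} (hr : Irrational r) (s : ℝ) :
    Function.Injective fun n : ℕ => (billiard r)^[n] s := by
  intro m n hmn
  obtain ⟨k, hk⟩ := billiard_iterate_eq r s m
  obtain ⟨l, hl⟩ := billiard_iterate_eq r s n
  dsimp only at hmn
  rw [hk, hl] at hmn
  have h := int_eq_zero_of_irrational_mul_eq hr (a := (m : ℤ) - n - (k - l)) (b := k - l)
    (by push_cast; linarith)
  omega

/-- An orbit and its reflection do not both run into a corner. -/
theorem billiard_iterate_ne_corner {r : ℝ} (hr : Irrational r) (s : ℝ) :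
    (∀ n, (billiard r)^[n] s ≠ 1 - r) ∨ ∀ n, (billiard r)^[n] (-s) ≠ 1 - r := by
  by_contra! h
  obtain ⟨⟨m, hm⟩, n, hn⟩ := h
  obtain ⟨k, hk⟩ := billiard_iterate_eq r s m
  obtain ⟨l, hl⟩ := billiard_iterate_eq r (-s) n
  -- Adding the two corner equations cancels `s`. Irrationality then gives `k + l = -1` and `m + n +
  -- 1 = -1`, impossible for natural numbers.
  have h := int_eq_zero_of_irrational_mul_eq hr (a := (m : ℤ) + n + 1 - (k + l)) (b := k + l + 1)
    (by push_cast; linarith)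
  omega

theorem reachable_billiard_iterate {α r s : ℝ} (hα : 0 < α) (hr : 0 < r) (hs : |s| < 1 + r)
    (hne : ∀ n, (billiard r)^[n] s ≠ 1 - r) (n : ℕ) :
    |(billiard r)^[n] s| < 1 + r ∧ Reachable α (s, r) ((billiard r)^[n] s, r) := by
  induction n with
  | zero => exact ⟨hs, Reachable.refl _⟩
  | succ n ih =>
    obtain ⟨h1, h2⟩ := ih
    rw [Function.iterate_succ_apply']
    have hn := hne n
    set x := (billiard r)^[n] s
    rw [abs_lt] at h1
    rw [billiard]
    split_ifs with h
    · refine ⟨abs_lt.2 ⟨by linarith, by linarith⟩, h2.trans (reachable_annulus hα ?_)⟩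
      exact abs_lt.2 ⟨by linarith, by linarith⟩
    -- The second branch of `billiard` includes the corner `x = 1 - r`, where the level is `1` and
    -- no move exists; `hne` excludes it.
    · have h' : 1 - r < x := lt_of_le_of_ne (not_lt.1 h) hn.symm
      exact ⟨abs_lt.2 ⟨by linarith, by linarith⟩, h2.trans (reachable_sub_two hα h' h1.2)⟩

theorem exists_injective_reachable {α r s : ℝ} (hα : 0 < α) (hr : 0 < r) (hir : Irrational r)
    (hs : |s| < 1 + r) :
    ∃ f : ℕ → ℝ, Function.Injective f ∧ ∀ n, Reachable α (s, r) (f n, r) := by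
  rcases billiard_iterate_ne_corner hir s with h | h
  · exact ⟨_, billiard_iterate_injective hir s, fun n => (reachable_billiard_iterate hα hr hs h n).2⟩
  · exact ⟨_, billiard_iterate_injective hir (-s), fun n => (reachable_neg_fst hα s r).trans
      (reachable_billiard_iterate hα hr (by rwa [abs_neg]) h n).2⟩

/-- A split torus outside the exceptional set can be moved over the upper side of its table. -/
theorem exists_reachable_upper_side {α x y : ℝ} (hα : 0 < α)
    (hr : Irrational (tableSize x y)) (hxy : (x, y) ∉ SigmaSet) :
    0 < tableSize x y ∧
      ∃ s, |s| < 1 + tableSize x y ∧ Reachable α (x, y) (s, tableSize x y) := by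
  have hr0 : 0 < tableSize x y :=
    lt_of_le_of_ne ((abs_nonneg y).trans (le_max_right _ _)) hr.ne_zero.symm
  refine ⟨hr0, ?_⟩
  have hne : |x| ≠ |y| + 1 := by
    intro h
    refine hxy (Or.inl ?_)
    rcases abs_choice x with h' | h'
    · exact Or.inl (by rw [← h', h])
    · exact Or.inr (by dsimp only; linarith)
  rcases lt_or_ge (|x| - 1) |y| with h | h
  · have ht : tableSize x y = |y| := max_eq_right h.le
    rw [ht]
    refine ⟨x, by linarith, ?_⟩
    rcases abs_choice y with h' | h'
    · rw [h']
      exact Reachable.refl _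
    · rw [h']
      exact reachable_neg_snd hα x y
  · have ht : tableSize x y = |x| - 1 := max_eq_left h
    have hlt : |y| < |x| - 1 := lt_of_le_of_ne h fun h' => hne (by linarith)
    have h0 : Reachable α (x, y) (|x|, y) := by
      rcases abs_choice x with h' | h'
      · rw [h']
        exact Reachable.refl _
      · rw [h']
        exact reachable_neg_fst hα x y
    rw [ht] at hr0 ⊢
    have hy := abs_lt.1 hlt
    -- The torus now lies over the right side of its table. As `|y| < |x| - 1`, its level `|x| + y`
    -- exceeds `1`, and a corner move takes it to the upper side.
    exact ⟨1 + y, by rw [abs_lt]; constructor <;> linarith,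
      h0.trans (reachable_corner hα (by linarith))⟩

/-- Split tori with different first heights are disjoint, so inclusion of each image in its target
torus suffices. -/
theorem packingNumber_eq_top_of_reachable {α r x y : ℝ} (hα : 0 < α) {f : ℕ → ℝ}
    (hf : Function.Injective f) (h : ∀ n, Reachable α (x, y) (f n, r)) :
    packingNumber (omega α) (splitTorus α x y) = ⊤ := by
  choose φ hφ hmaps using h
  rw [ENat.eq_top_iff_forall_ge]
  intro n
  refine le_sSup ⟨n, rfl, fun i => φ i, fun i => hφ i, fun i j hij => ?_⟩
  rw [Set.disjoint_left]
  rintro _ ⟨q, hq, rfl⟩ ⟨q', hq', he⟩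
  have h1 := (mem_splitTorus_iff hα).1 (hmaps i q hq)
  have h2 := (mem_splitTorus_iff hα).1 (hmaps j q' hq')
  dsimp only at he
  rw [he] at h2
  exact hij (Fin.ext (hf (h1.1.symm.trans h2.1)))

end Billiard

end SplitPacking
end

theorem corollary1p6 (α : ℝ) (hα : 0 < α) (x y : ℝ)
    (hx : x ∈ Set.Ioo (-1 - α) (1 + α)) (hy : y ∈ Set.Ioo (-α) α)
    (hr : Irrational (SplitPacking.tableSize x y)) (hxy : (x, y) ∉ SplitPacking.SigmaSet) :
    SplitPacking.packingNumber (SplitPacking.omega α) (SplitPacking.splitTorus α x y) = ⊤ := by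
  obtain ⟨hr0, s, hs, hreach⟩ := SplitPacking.exists_reachable_upper_side hα hr hxy
  obtain ⟨f, hf, hfr⟩ := SplitPacking.exists_injective_reachable hα hr0 hr hs
  exact SplitPacking.packingNumber_eq_top_of_reachable hα hf fun n => hreach.trans (hfr n)
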